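/- Let $\lambda\in C^1([0,1]\times[0,\infty))$ with $\lambda>0$, let $T>0$, and for nonnegative $\rho_0\in L^\infty(0,1)$ and $u\in L^\infty(0,T)$ consider the Cauchy problem $$\rho_t(t,x)+\big(\rho(t,x)\lambda(x,W(t))\big)_x=0,\qquad W(t)=\int_0^1\rho(t,x)\,dx,\qquad \rho(0,x)=\rho_0(x),\qquad \rho(t,0)\lambda(0,W(t))=u(t)$$ for $0\le t\le T$, $0\le x\le 1$. A weak solution is a function $\rho\in C^0([0,T];L^1(0,1))\cap L^\infty((0,T)\times(0,1))$ (with $W\ge 0$ on $[0,T]$, so that $\lambda(x,W(t))$ is defined) such that for every $\tau\in[0,T]$ and every $\varphi\in C^1([0,\tau]\times[0,1])$ with $\varphi(\tau,\cdot)=0$ and $\varphi(\cdot,1)=0$, $$\int_0^\tau\!\!\int_0^1\rho(t,x)\big(\varphi_t(t,x)+\lambda(x,W(t))\varphi_x(t,x)\big)\,dx\,dt+\int_0^\tau u(t)\varphi(t,0)\,dt+\int_0^1\rho_0(x)\varphi(0,x)\,dx=0.$$ **Theorem.** Let $\lambda$, $T$ and nonnegative data $\rho_0\in L^\infty(0,1)$,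 $u\in L^\infty(0,T)$ be given. For every $\varepsilon>0$, every $p\in[1,\infty)$ and every $K>0$ with $\|\rho_0\|_{L^\infty(0,1)}+\|u\|_{L^\infty(0,T)}\le K$ there is $\eta>0$ (depending on $\varepsilon,p,K$ and on the given $\lambda,T,\rho_0,u$, but not on the perturbed data) with the following property. Let $\bar\rho_0\in L^\infty(0,1)$ and $\bar u\in L^\infty(0,T)$ be nonnegative with $\|\bar\rho_0\|_{L^\infty(0,1)}+\|\bar u\|_{L^\infty(0,T)}\le K$ and $$\|\bar\rho_0-\rho_0\|_{L^p(0,1)}+\|\bar u-u\|_{L^p(0,T)}<\eta .$$ If $\rho$ and $\bar\rho$ are weak solutions of the Cauchy problem with data $(\rho_0,u)$ and $(\bar\rho_0,\bar u)$ respectively, then $$\|\bar\rho(t,\cdot)-\rho(t,\cdot)\|_{L^p(0,1)}<\varepsilon\qquad\text{for all } t\in[0,T].$$ -/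

import Mathlib

open Set Filter Topology MeasureTheory
open scoped ENNReal

namespace NonlocalFlow

/-- Lebesgue measure on the open interval `(a, b)`. -/
noncomputable def leb (a b : ℝ) : Measure ℝ := volume.restrict (Ioo a b)

/-- `f` represents an element of `L^∞_+(a, b)`: essentially bounded, nonnegative a.e. -/
structure IsLinftyPlus (a b : ℝ) (f : ℝ → ℝ) : Prop where
  memLp : MemLp f ∞ (leb a b)
  nonneg : ∀ᵐ x ∂(leb a b), 0 ≤ f x

/-- An admissible velocity `lam = lam(x, W)`: of class `C^1` on `[0,1] × [0,∞)` and positive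
there. Its values elsewhere are irrelevant. -/
structure IsVelocity (lam : ℝ → ℝ → ℝ) : Prop where
  contDiffOn : ContDiffOn ℝ 1 (fun z : ℝ × ℝ => lam z.1 z.2) (Icc 0 1 ×ˢ Ici 0)
  pos : ∀ x ∈ Icc (0 : ℝ) 1, ∀ w ∈ Ici (0 : ℝ), 0 < lam x w

/-- The total mass `W(t) = ∫₀¹ ρ(t, x) dx`. -/
noncomputable def mass (rho : ℝ → ℝ → ℝ) (t : ℝ) : ℝ := ∫ x in (0 : ℝ)..1, rho t x

/-- Test functions on `[0, τ] × [0, 1]`: of class `C^1` up to the boundary, vanishing at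
`t = τ` and at `x = 1`. -/
structure IsTest (tau : ℝ) (phi : ℝ → ℝ → ℝ) : Prop where
  contDiffOn : ContDiffOn ℝ 1 (fun z : ℝ × ℝ => phi z.1 z.2) (Icc 0 tau ×ˢ Icc 0 1)
  final : ∀ x ∈ Icc (0 : ℝ) 1, phi tau x = 0
  right : ∀ t ∈ Icc (0 : ℝ) tau, phi t 1 = 0

/-- `rho` (with `rho t` the density at time `t`) is a weak solution on `[0, T] × [0, 1]` of
`ρ_t + (ρ lam(x, W(t)))_x = 0`, `ρ(0, x) = rho0 x`, `ρ(t, 0) lam(0, W(t)) = u t`. -/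
structure IsWeakSolution (lam : ℝ → ℝ → ℝ) (T : ℝ) (rho0 u : ℝ → ℝ) (rho : ℝ → ℝ → ℝ) :
    Prop where
  /-- `rho` maps `[0, T]` to `L^1(0, 1)`, -/
  memLp_one : ∀ t ∈ Icc 0 T, MemLp (rho t) 1 (leb 0 1)
  /-- continuously, -/
  continuous_L1 : ∀ s ∈ Icc 0 T,
    Tendsto (fun t => eLpNorm (fun x => rho t x - rho s x) 1 (leb 0 1)) (𝓝[Icc 0 T] s) (𝓝 0)
  /-- and belongs to `L^∞((0, T) × (0, 1))`. -/
  memLp_top : MemLp (fun z : ℝ × ℝ => rho z.1 z.2) ∞ (volume.restrict (Ioo 0 T ×ˢ Ioo 0 1))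
  /-- The mass stays in `[0, ∞)`, where the velocity `lam(x, ·)` is defined. -/
  mass_nonneg : ∀ t ∈ Icc 0 T, 0 ≤ mass rho t
  /-- The weak form of the equation, the initial condition and the boundary condition. -/
  weak_form : ∀ tau ∈ Icc 0 T, ∀ phi : ℝ → ℝ → ℝ, IsTest tau phi →
    (∫ t in (0 : ℝ)..tau, ∫ x in (0 : ℝ)..1,
        rho t x * (derivWithin (fun s => phi s x) (Icc 0 tau) t
          + lam x (mass rho t) * derivWithin (fun y => phi t y) (Icc 0 1) x))
      + (∫ t in (0 : ℝ)..tau, u t * phi t 0)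
      + (∫ x in (0 : ℝ)..1, rho0 x * phi 0 x) = 0

end NonlocalFlow

/-!
The proof follows characteristics. Fix a weak solution `rho` with mass `W`. The velocity
`lam (x, W t)` is `C^1` in `x` and continuous in `t`; extended to the whole line it generates a
global flow `X s t x` (the position at time `s` of the characteristic through `x` at time `t`).
In one space dimension the difference of two characteristics solves a scalar linear equation, so
`X` is given by an explicit exponential formula (`flow_sub`), and this is what makes it `C^1` in
`(t, x)`, with space derivative `jac`. Hence `F (X τ t x)`, cut off in time near `τ`, is an
admissible test function, and the weak form becomes (`weak_representation`)

  `∫ rho τ x * F x dx = ∫ rho0 x * F (X τ 0 x) dx + ∫_0^τ u t * F (X τ t 0) dt`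

for every `C^1` function `F` vanishing on `[1, ∞)`. Everything else is extracted from this identity.

* Letting `F` increase to the indicator of `(-∞, 1)` bounds the mass by `K * (1 + T)` (`mass_le`), so
  that one compact range of masses serves all the solutions; nonnegative `F` give a uniform
  `L^∞` bound (`ae_abs_le`).
* For two solutions, antitone `F` bound the difference of the masses at time `τ` by the distance of
  the data plus a constant times the integral of that difference over `[0, τ]`, since two flows differ
  by at most such an integral. Grönwall yields Lipschitz dependence of the mass, hence of the flow, on
  the data in `L^1` (`abs_mass_sub_le`, `abs_flow_sub_le_dataDist`). The space derivatives of the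
  flows are then uniformly close, by uniform continuity of `∂ₓ lam` (`exists_jac_close`).
* To compare the densities in `L^1`, the data are replaced by continuous functions `g`, and
  `∫ g * (F (X') - F (X))` has to be small uniformly in `|F| ≤ 1`. With `k = g / ∂ₓ X` this is, up to
  the difference of the derivatives, the integral of `k` against the derivative of `Φ (X') - Φ (X)`
  where `Φ` is a primitive of `F`; replacing `k` by a Steklov average and integrating by parts leaves
  only the sup norm of `X' - X` (`abs_integral_mul_comp_sub_comp_le`).

The convergence in `L^p` follows from that in `L^1` and the uniform bound. The modulus in the third
item depends on the reference solution, so `eta` is chosen for one fixed solution with the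
unperturbed data, and both solutions in the statement are compared with that one.
-/

namespace NonlocalFlow

/-! ### Extension of the velocity to the plane -/

/-- `v` is a bounded extension to the plane of the velocity `lam` restricted to `[0, 1] × [0, M]`.
Differentiability in `x` is encoded by a continuous difference quotient `Q`, so that `Q x x w` is
the derivative of `v` in `x`. A single constant `L` bounds `v`, `Q` and the Lipschitz constant in
`w`. Positivity is only kept at the two end points of the unit interval. -/
structure IsVelocityExtension (lam : ℝ → ℝ → ℝ) (M L c : ℝ) (v : ℝ → ℝ → ℝ)
    (Q : ℝ → ℝ → ℝ → ℝ) : Prop where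
  cont : Continuous fun z : ℝ × ℝ => v z.1 z.2
  cont_slope : Continuous fun z : ℝ × ℝ × ℝ => Q z.1 z.2.1 z.2.2
  slope : ∀ x y w, v y w - v x w = Q x y w * (y - x)
  bound : ∀ x w, |v x w| ≤ L
  slope_bound : ∀ x y w, |Q x y w| ≤ L
  lipschitz : ∀ x w w', |v x w - v x w'| ≤ L * |w - w'|
  eq : ∀ x ∈ Icc (0 : ℝ) 1, ∀ w ∈ Icc 0 M, v x w = lam x w
  c_pos : 0 < c
  left : ∀ w, c ≤ v 0 w
  right : ∀ w, 0 < v 1 w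

/-- A continuous retraction of the line onto `[0, 1]`: the identity on `[0, 1]`,
`1 / x` for `x ≥ 1` and `1 - 1 / (1 - x)` for `x ≤ 0`. It has slope `-1` on the outer sides of `0`
and `1`, so that `2 f (clampUnit x) - f (reflect x)` is a `C^1` extension of `f`. -/
noncomputable def reflect (x : ℝ) : ℝ := |min x 1| / (max 1 x * max 1 (1 - x))

lemma reflect_of_mem {x : ℝ} (hx : x ∈ Icc (0 : ℝ) 1) : reflect x = x := by
  have h1 : max 1 x = 1 := max_eq_left hx.2
  have h2 : max 1 (1 - x) = 1 := max_eq_left (by linarith [hx.1])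
  simp [reflect, h1, h2, min_eq_left hx.2, abs_of_nonneg hx.1]

lemma reflect_of_one_le {x : ℝ} (hx : 1 ≤ x) : reflect x = 1 / x := by
  have h1 : max 1 x = x := max_eq_right hx
  have h2 : max 1 (1 - x) = 1 := max_eq_left (by linarith)
  simp [reflect, h1, h2, min_eq_right hx]

lemma reflect_of_nonpos {x : ℝ} (hx : x ≤ 0) : reflect x = 1 - 1 / (1 - x) := by
  have h1 : max 1 x = 1 := max_eq_left (by linarith)
  have h2 : max 1 (1 - x) = 1 - x := max_eq_right (by linarith)
  have h3 : (1 - x) ≠ 0 := by linarith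
  simp only [reflect, h1, h2, min_eq_left (by linarith : x ≤ 1), abs_of_nonpos hx]
  field_simp
  ring

lemma continuous_reflect : Continuous reflect := by
  unfold reflect
  refine Continuous.div (by fun_prop) (by fun_prop) fun x => ?_
  positivity

lemma reflect_mem (x : ℝ) : reflect x ∈ Icc (0 : ℝ) 1 := by
  rcases le_total x 0 with h | h
  · rw [reflect_of_nonpos h]
    have : 1 ≤ 1 - x := by linarith
    have h2 : 1 / (1 - x) ≤ 1 := by rw [div_le_one (by linarith)]; exact this
    have h3 : 0 ≤ 1 / (1 - x) := by positivity
    constructor <;> linarith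
  · rcases le_total x 1 with h' | h'
    · rw [reflect_of_mem ⟨h, h'⟩]; exact ⟨h, h'⟩
    · rw [reflect_of_one_le h']
      exact ⟨by positivity, by rw [div_le_one (by linarith)]; exact h'⟩

/-- The projection of the line onto `[0, 1]`. -/
noncomputable def clampUnit (x : ℝ) : ℝ := max 0 (min 1 x)

lemma clampUnit_mem (x : ℝ) : clampUnit x ∈ Icc (0 : ℝ) 1 := by
  constructor <;> simp [clampUnit]

lemma clampUnit_of_mem {x : ℝ} (hx : x ∈ Icc (0 : ℝ) 1) : clampUnit x = x := by
  simp [clampUnit, hx.1, hx.2]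

/-- The absolute value of the slope of `reflect`. -/
noncomputable def reflectWeight (x : ℝ) : ℝ := 1 / (max 1 x * max 1 (1 - x)) ^ 2

lemma continuous_reflectWeight : Continuous reflectWeight := by
  unfold reflectWeight
  refine Continuous.div (by fun_prop) (by fun_prop) fun x => ?_
  positivity

lemma reflectWeight_mem (x : ℝ) : reflectWeight x ∈ Icc (0 : ℝ) 1 := by
  unfold reflectWeight
  refine ⟨by positivity, ?_⟩
  rw [div_le_one (by positivity)]
  have h1 : 1 ≤ max 1 x := le_max_left _ _
  have h2 : 1 ≤ max 1 (1 - x) := le_max_left _ _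
  exact one_le_pow₀ (one_le_mul_of_one_le_of_one_le h1 h2)

/-- The points `0` and `1` can be left out because the derivative is continuous and only its
integral is used. -/
lemma hasDerivAt_reflect_extension {f f' : ℝ → ℝ}
    (hd : ∀ x ∈ Ioo (0 : ℝ) 1, HasDerivAt f (f' x) x) {x : ℝ} (h0 : x ≠ 0) (h1 : x ≠ 1) :
    HasDerivAt (fun x => 2 * f (clampUnit x) - f (reflect x))
      (f' (reflect x) * reflectWeight x) x := by
  rcases lt_or_gt_of_ne h0 with h | h
  · have e : (fun x => 2 * f (clampUnit x) - f (reflect x)) =ᶠ[𝓝 x]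
        fun x => 2 * f 0 - f (1 - 1 / (1 - x)) := by
      filter_upwards [Iio_mem_nhds h] with y hy
      rw [reflect_of_nonpos (le_of_lt hy)]
      have : clampUnit y = 0 := by
        have : y < 0 := hy
        simp [clampUnit, min_eq_right (by linarith : y ≤ 1), this.le]
      rw [this]
    refine HasDerivAt.congr_of_eventuallyEq ?_ e
    have hx : (1 - x) ≠ 0 := by linarith
    have hr : reflect x ∈ Ioo (0 : ℝ) 1 := by
      rw [reflect_of_nonpos h.le]
      have h2 : 1 / (1 - x) < 1 := by rw [div_lt_one (by linarith)]; linarith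
      have h3 : 0 < 1 / (1 - x) := by apply one_div_pos.2; linarith
      constructor <;> linarith
    have hw : reflectWeight x = 1 / (1 - x) ^ 2 := by
      have h1 : max 1 x = 1 := max_eq_left (by linarith)
      have h2 : max 1 (1 - x) = 1 - x := max_eq_right (by linarith)
      simp [reflectWeight, h1, h2]
    have hd' := hd _ hr
    have hi : HasDerivAt (fun x : ℝ => 1 - 1 / (1 - x)) (-(1 / (1 - x) ^ 2)) x := by
      have := (((hasDerivAt_id x).const_sub 1).inv hx).const_sub 1
      refine (this.congr_deriv ?_).congr_of_eventuallyEq (Eventually.of_forall fun y => ?_)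
      · simp
      · simp
    rw [reflect_of_nonpos h.le] at hd'
    have := (HasDerivAt.comp x hd' hi).const_sub (2 * f 0)
    rw [hw, reflect_of_nonpos h.le]
    refine this.congr_deriv ?_
    ring
  · rcases lt_or_gt_of_ne h1 with h' | h'
    · have e : (fun x => 2 * f (clampUnit x) - f (reflect x)) =ᶠ[𝓝 x] f := by
        filter_upwards [Ioo_mem_nhds h h'] with y hy
        rw [reflect_of_mem ⟨hy.1.le, hy.2.le⟩, clampUnit_of_mem ⟨hy.1.le, hy.2.le⟩]
        ring
      refine HasDerivAt.congr_of_eventuallyEq ?_ e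
      have hw : reflectWeight x = 1 := by
        have h1 : max 1 x = 1 := max_eq_left (by linarith)
        have h2 : max 1 (1 - x) = 1 := max_eq_left (by linarith)
        simp [reflectWeight, h1, h2]
      rw [hw, reflect_of_mem ⟨h.le, h'.le⟩, mul_one]
      exact hd x ⟨h, h'⟩
    · have e : (fun x => 2 * f (clampUnit x) - f (reflect x)) =ᶠ[𝓝 x]
          fun x => 2 * f 1 - f (1 / x) := by
        filter_upwards [Ioi_mem_nhds h'] with y hy
        have hy : 1 < y := hy
        rw [reflect_of_one_le hy.le]
        have : clampUnit y = 1 := by simp [clampUnit, min_eq_left hy.le]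
        rw [this]
      refine HasDerivAt.congr_of_eventuallyEq ?_ e
      have hr : reflect x ∈ Ioo (0 : ℝ) 1 := by
        rw [reflect_of_one_le h'.le]
        exact ⟨by positivity, by rw [div_lt_one h]; exact h'⟩
      have hw : reflectWeight x = 1 / x ^ 2 := by
        have h1 : max 1 x = x := max_eq_right h'.le
        have h2 : max 1 (1 - x) = 1 := max_eq_left (by linarith)
        simp [reflectWeight, h1, h2]
      have hd' := hd _ hr
      have hi : HasDerivAt (fun x : ℝ => 1 / x) (-(1 / x ^ 2)) x := by
        have := hasDerivAt_inv h0
        simpa [one_div] using this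
      rw [reflect_of_one_le h'.le] at hd'
      have := (HasDerivAt.comp x hd' hi).const_sub (2 * f 1)
      rw [hw, reflect_of_one_le h'.le]
      refine this.congr_deriv ?_
      ring

/-- Hadamard's lemma on the line, for a derivative that may be unknown on a countable set. -/
lemma sub_eq_integral_slope {f f' : ℝ → ℝ} (hf : Continuous f) (hf' : Continuous f')
    {s : Set ℝ} (hs : s.Countable) (hd : ∀ x, x ∉ s → HasDerivAt f (f' x) x) (x y : ℝ) :
    f y - f x = (∫ θ in (0 : ℝ)..1, f' (x + θ * (y - x))) * (y - x) := by
  have h := integral_eq_of_hasDerivAt_off_countable f f' (a := x) (b := y) hs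
    hf.continuousOn (fun z hz => hd z hz.2) (hf'.intervalIntegrable _ _)
  rw [← h]
  have h2 := intervalIntegral.mul_integral_comp_add_mul (f := f') (a := 0) (b := 1) (y - x) x
  simp only [mul_zero, add_zero, mul_one, add_sub_cancel] at h2
  rw [← h2, mul_comm]
  congr 2
  ext θ
  rw [mul_comm]

/-- The extension is `2 lam (clampUnit x) - lam (reflect x)` with `w` clamped to `[0, M]`. In contrast
with an extension by Taylor polynomials it stays Lipschitz in `w`. -/
lemma exists_velocityExtension {lam : ℝ → ℝ → ℝ} (hlam : IsVelocity lam) {M : ℝ} (hM : 0 ≤ M) :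
    ∃ L c v Q, IsVelocityExtension lam M L c v Q := by
  set S : Set (ℝ × ℝ) := Icc 0 1 ×ˢ Ici 0
  set f : ℝ × ℝ → ℝ := fun z => lam z.1 z.2
  have hS : UniqueDiffOn ℝ S :=
    (uniqueDiffOn_Icc zero_lt_one).prod (uniqueDiffOn_Ici 0)
  have hcd : ContinuousOn (fderivWithin ℝ f S) S :=
    hlam.contDiffOn.continuousOn_fderivWithin hS le_rfl
  have hdiff : ∀ z ∈ S, HasFDerivWithinAt f (fderivWithin ℝ f S z) S z := fun z hz =>
    (hlam.contDiffOn.differentiableOn one_ne_zero z hz).hasFDerivWithinAt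
  have hcf : ContinuousOn f S := hlam.contDiffOn.continuousOn
  set S₁ : Set (ℝ × ℝ) := Icc 0 1 ×ˢ Icc 0 M
  have hS₁ : S₁ ⊆ S := prod_mono subset_rfl Icc_subset_Ici_self
  have hK : IsCompact S₁ := isCompact_Icc.prod isCompact_Icc
  obtain ⟨A, hA⟩ := hK.exists_bound_of_continuousOn (hcd.mono hS₁)
  obtain ⟨B, hB⟩ := hK.exists_bound_of_continuousOn (hcf.mono hS₁)
  have hne : S₁.Nonempty := ⟨(0, 0), by simp [S₁, hM]⟩
  obtain ⟨z₀, hz₀, hmin⟩ := hK.exists_isMinOn hne (hcf.mono hS₁)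
  have hA0 : 0 ≤ A := (norm_nonneg _).trans (hA _ hz₀)
  have hB0 : 0 ≤ B := (norm_nonneg _).trans (hB _ hz₀)
  -- clamping of the second variable
  set cl : ℝ → ℝ := fun w => max 0 (min M w)
  have hcl : ∀ w, cl w ∈ Icc 0 M := fun w => ⟨le_max_left _ _, max_le hM (min_le_left _ _)⟩
  have hclc : Continuous cl := by fun_prop
  have hcllip : ∀ w w', |cl w - cl w'| ≤ |w - w'| := fun w w' => by
    have h1 := abs_max_sub_max_le_max 0 (min M w) 0 (min M w')
    have h2 := abs_min_sub_min_le_max M w M w'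
    exact h1.trans (max_le (by simp) (h2.trans (max_le (by simp) le_rfl)))
  set p : ℝ × ℝ → ℝ := fun z => fderivWithin ℝ f S z (1, 0)
  have hpc : ContinuousOn p S := hcd.clm_apply continuousOn_const
  have hPm : ∀ x w, (clampUnit x, cl w) ∈ S₁ := fun x w => ⟨clampUnit_mem x, hcl w⟩
  have hRm : ∀ x w, (reflect x, cl w) ∈ S₁ := fun x w => ⟨reflect_mem x, hcl w⟩
  set v : ℝ → ℝ → ℝ := fun x w => 2 * lam (clampUnit x) (cl w) - lam (reflect x) (cl w)
  set q : ℝ → ℝ → ℝ := fun x w => p (reflect x, cl w) * reflectWeight x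
  have hcP : Continuous clampUnit := by unfold clampUnit; fun_prop
  have hcont : Continuous fun z : ℝ × ℝ => v z.1 z.2 := by
    refine Continuous.sub (continuous_const.mul ?_) ?_
    · exact hcf.comp_continuous (f := fun z : ℝ × ℝ => (clampUnit z.1, cl z.2)) (by fun_prop)
        fun z => hS₁ (hPm _ _)
    · exact hcf.comp_continuous (f := fun z : ℝ × ℝ => (reflect z.1, cl z.2))
        ((continuous_reflect.comp continuous_fst).prodMk (by fun_prop)) fun z => hS₁ (hRm _ _)
  have hqc : Continuous fun z : ℝ × ℝ => q z.1 z.2 := by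
    refine Continuous.mul ?_ (continuous_reflectWeight.comp continuous_fst)
    exact hpc.comp_continuous (f := fun z : ℝ × ℝ => (reflect z.1, cl z.2))
        ((continuous_reflect.comp continuous_fst).prodMk (by fun_prop)) fun z => hS₁ (hRm _ _)
  have hpx : ∀ w ∈ Icc 0 M, ∀ x ∈ Ioo (0 : ℝ) 1, HasDerivAt (fun x => lam x w) (p (x, w)) x := by
    intro w hw x hx
    have hz : (x, w) ∈ S := ⟨⟨hx.1.le, hx.2.le⟩, hw.1⟩
    have h1 : HasDerivWithinAt (fun x : ℝ => (x, w)) ((1 : ℝ), (0 : ℝ)) (Icc 0 1) x :=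
      (hasDerivWithinAt_id _ _).prodMk (hasDerivWithinAt_const _ _ _)
    have h2 := (hdiff _ hz).comp_hasDerivWithinAt x h1 (fun y hy => (⟨hy, hw.1⟩ : (y, w) ∈ S))
    exact h2.hasDerivAt (Icc_mem_nhds hx.1 hx.2)
  have hq : ∀ x w, |q x w| ≤ A := by
    intro x w
    have h1 : |p (reflect x, cl w)| ≤ A := by
      calc |p (reflect x, cl w)| ≤ ‖fderivWithin ℝ f S (reflect x, cl w)‖ * ‖((1 : ℝ), (0 : ℝ))‖ :=
            (fderivWithin ℝ f S (reflect x, cl w)).le_opNorm (1, 0)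
        _ ≤ A * 1 := by
            gcongr
            · exact hA _ (hRm x w)
            · simp
        _ = A := mul_one A
    obtain ⟨h2, h3⟩ := reflectWeight_mem x
    rw [abs_mul, abs_of_nonneg h2]
    calc _ ≤ A * 1 := by gcongr
      _ = A := mul_one A
  have hlip : ∀ x ∈ Icc (0 : ℝ) 1, ∀ w w', |lam x (cl w) - lam x (cl w')| ≤ A * |w - w'| := by
    intro x hx w w'
    have hconv : Convex ℝ S₁ := (convex_Icc _ _).prod (convex_Icc _ _)
    have := hconv.norm_image_sub_le_of_norm_hasFDerivWithin_le
      (f := f) (f' := fderivWithin ℝ f S) (C := A)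
      (fun z hz => (hdiff z (hS₁ hz)).mono hS₁) hA
      (x := (x, cl w')) (y := (x, cl w)) ⟨hx, hcl _⟩ ⟨hx, hcl _⟩
    simp only [f, Prod.mk_sub_mk, sub_self, Prod.norm_mk, norm_zero, Real.norm_eq_abs] at this
    rw [max_eq_right (abs_nonneg _)] at this
    exact this.trans (by exact mul_le_mul_of_nonneg_left (hcllip _ _) hA0)
  have hlamB : ∀ z ∈ S₁, |lam z.1 z.2| ≤ B := fun z hz => hB z hz
  have hslope : ∀ x y w, v y w - v x w = (∫ θ in (0 : ℝ)..1, q (x + θ * (y - x)) w) * (y - x) := by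
    intro x y w
    refine sub_eq_integral_slope (f := fun x => v x w) (f' := fun x => q x w)
      (hcont.comp (by fun_prop : Continuous fun x : ℝ => (x, w)))
      (hqc.comp (by fun_prop : Continuous fun x : ℝ => (x, w)))
      (s := {0, 1}) (by simp) (fun z hz => ?_) x y
    simp only [mem_insert_iff, mem_singleton_iff, not_or] at hz
    exact hasDerivAt_reflect_extension (f := fun x => lam x (cl w))
      (f' := fun x => p (x, cl w)) (hpx (cl w) (hcl w)) hz.1 hz.2
  have hQc : Continuous fun z : ℝ × ℝ × ℝ =>
      ∫ θ in (0 : ℝ)..1, q (z.1 + θ * (z.2.1 - z.1)) z.2.2 := by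
    apply intervalIntegral.continuous_parametric_intervalIntegral_of_continuous'
    exact hqc.comp (f := fun y : (ℝ × ℝ × ℝ) × ℝ =>
      (y.1.1 + y.2 * (y.1.2.1 - y.1.1), y.1.2.2)) (by fun_prop)
  have hveq : ∀ x ∈ Icc (0 : ℝ) 1, ∀ w, v x w = lam x (cl w) := by
    intro x hx w
    simp only [v, clampUnit_of_mem hx, reflect_of_mem hx]
    ring
  refine ⟨3 * A + 3 * B, f z₀, v,
    fun x y w => ∫ θ in (0 : ℝ)..1, q (x + θ * (y - x)) w, hcont, hQc, hslope, ?_, ?_, ?_, ?_, ?_,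
    ?_, ?_⟩
  · intro x w
    have h1 := abs_le.1 (hlamB _ (hPm x w))
    have h2 := abs_le.1 (hlamB _ (hRm x w))
    simp only at h1 h2
    rw [abs_le]
    constructor <;> simp only [v] <;> linarith
  · intro x y w
    have := intervalIntegral.norm_integral_le_of_norm_le_const (a := 0) (b := 1) (C := A)
      (f := fun θ : ℝ => q (x + θ * (y - x)) w) (fun θ _ => hq _ _)
    simp only [Real.norm_eq_abs, sub_zero, abs_one, mul_one] at this
    linarith
  · intro x w w'
    have h1 := abs_le.1 (hlip _ (clampUnit_mem x) w w')
    have h2 := abs_le.1 (hlip _ (reflect_mem x) w w')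
    have h3 : 0 ≤ B * |w - w'| := by positivity
    rw [abs_le]
    constructor <;> simp only [v] <;> nlinarith
  · intro x hx w hw
    rw [hveq x hx]
    congr 1
    simp [cl, hw.1, hw.2]
  · exact hlam.pos _ (hS₁ hz₀).1 _ (hS₁ hz₀).2
  · intro w
    rw [hveq 0 (by simp)]
    exact hmin (show ((0 : ℝ), cl w) ∈ S₁ from ⟨by simp, hcl w⟩)
  · intro w
    rw [hveq 1 (by simp)]
    exact hlam.pos 1 (by simp) _ (hcl w).1

/-! ### The characteristic flow -/

/-- A bounded, globally Lipschitz field has solutions on the whole line: by boundedness the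
Picard–Lindelöf theorem applies on every compact interval around `t₀`. -/
lemma exists_global_solution {b : ℝ → ℝ → ℝ} (hc : Continuous fun z : ℝ × ℝ => b z.1 z.2)
    {L : ℝ} (hbd : ∀ t x, |b t x| ≤ L) (hlip : ∀ t x y, |b t x - b t y| ≤ L * |x - y|)
    (t₀ x₀ : ℝ) : ∃ γ : ℝ → ℝ, γ t₀ = x₀ ∧ ∀ s, HasDerivAt γ (b s (γ s)) s := by
  have hL : 0 ≤ L := (abs_nonneg _).trans (hbd 0 0)
  have hlip' : ∀ t, LipschitzWith L.toNNReal (b t) := fun t =>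
    LipschitzWith.of_dist_le_mul fun x y => by
      simpa [Real.dist_eq, Real.coe_toNNReal L hL] using hlip t x y
  have hloc : ∀ N : ℕ, ∃ γ : ℝ → ℝ, γ t₀ = x₀ ∧
      ∀ s ∈ Ioo (t₀ - (N + 1)) (t₀ + (N + 1)), HasDerivAt γ (b s (γ s)) s := by
    intro N
    have hN : (0 : ℝ) < N + 1 := by positivity
    have hmem : t₀ ∈ Icc (t₀ - (N + 1)) (t₀ + (N + 1)) := by constructor <;> linarith
    have hPL : IsPicardLindelof b (⟨t₀, hmem⟩ : Icc (t₀ - ((N : ℝ) + 1)) (t₀ + (N + 1))) x₀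
        (L * (N + 1)).toNNReal 0 L.toNNReal L.toNNReal :=
      { lipschitzOnWith := fun t _ => (hlip' t).lipschitzOnWith
        continuousOn := fun x _ => (hc.comp (by fun_prop : Continuous fun t : ℝ => (t, x))).continuousOn
        norm_le := fun t _ x _ => by
          rw [Real.coe_toNNReal L hL]; exact hbd t x
        mul_max_le := by
          have h1 : t₀ + (↑N + 1) - t₀ = (N : ℝ) + 1 := by ring
          have h2 : t₀ - (t₀ - (↑N + 1)) = (N : ℝ) + 1 := by ring
          simp only [h1, h2, max_self]
          rw [Real.coe_toNNReal L hL, Real.coe_toNNReal _ (by positivity)]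
          simp }
    obtain ⟨γ, h1, h2⟩ := hPL.exists_eq_forall_mem_Icc_hasDerivWithinAt₀
    exact ⟨γ, h1, fun s hs => (h2 s ⟨hs.1.le, hs.2.le⟩).hasDerivAt (Icc_mem_nhds hs.1 hs.2)⟩
  choose γ hγ0 hγ using hloc
  have huniq : ∀ m n : ℕ, m ≤ n → ∀ s ∈ Ioo (t₀ - (m + 1)) (t₀ + (m + 1)), γ m s = γ n s := by
    intro m n hmn s hs
    have hmn' : (m : ℝ) ≤ n := by exact_mod_cast hmn
    have hm : (0 : ℝ) ≤ m := by positivity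
    refine ODE_solution_unique_of_mem_Ioo (v := b) (s := fun _ => univ) (K := L.toNNReal)
      (a := t₀ - (m + 1)) (b := t₀ + (m + 1)) (t₀ := t₀)
      (fun t _ => (hlip' t).lipschitzOnWith) ⟨by linarith, by linarith⟩
      (fun t ht => ⟨hγ m t ht, mem_univ _⟩)
      (fun t ht => ⟨hγ n t ⟨by linarith [ht.1], by linarith [ht.2]⟩, mem_univ _⟩) ?_ hs
    rw [hγ0, hγ0]
  have hval : ∀ (N : ℕ) (s : ℝ), |s - t₀| ≤ N → γ ⌈|s - t₀|⌉₊ s = γ N s := by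
    intro N s hs
    have h := Nat.le_ceil |s - t₀|
    have h' := abs_le.1 h
    exact huniq _ _ (Nat.ceil_le.2 hs) s ⟨by linarith, by linarith⟩
  -- the solutions on the intervals of radius `N + 1` agree where both are defined, and are glued
  refine ⟨fun s => γ ⌈|s - t₀|⌉₊ s, hγ0 _, fun s => ?_⟩
  set N := ⌈|s - t₀| + 1⌉₊
  have hN : |s - t₀| + 1 ≤ N := Nat.le_ceil _
  have hev : (fun s => γ ⌈|s - t₀|⌉₊ s) =ᶠ[𝓝 s] γ N := by
    have hcont : Continuous fun r : ℝ => |r - t₀| := by fun_prop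
    filter_upwards [hcont.continuousAt.eventually_lt (continuousAt_const (y := (N : ℝ)))
      (by linarith)] with r hr
    exact hval N r hr.le
  have hs := abs_le.1 (by linarith : |s - t₀| ≤ N)
  have := hγ N s ⟨by linarith, by linarith⟩
  have hsN : γ ⌈|s - t₀|⌉₊ s = γ N s := hval N s (by linarith)
  rw [← hsN] at this
  exact this.congr_of_eventuallyEq hev

/-- `X s t x` is the position at time `s` of the integral curve of `b` that is at `x` at time `t`. -/
structure IsFlow (b : ℝ → ℝ → ℝ) (X : ℝ → ℝ → ℝ → ℝ) : Prop where
  init : ∀ t x, X t t x = x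
  deriv : ∀ s t x, HasDerivAt (fun s => X s t x) (b s (X s t x)) s

/-- Variation of constants for a scalar linear equation. -/
lemma linear_ode_solution {E c b : ℝ → ℝ} (hc : Continuous c) (hb : Continuous b)
    (hE : ∀ s, HasDerivAt E (c s * E s + b s) s) (t s : ℝ) :
    E s = Real.exp (∫ r in t..s, c r) * E t + ∫ r in t..s, Real.exp (∫ q in r..s, c q) * b r := by
  have hI : ∀ r, HasDerivAt (fun r => ∫ q in r..s, c q) (-c r) r := fun r =>
    intervalIntegral.integral_hasDerivAt_left (hc.intervalIntegrable _ _)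
      (hc.stronglyMeasurableAtFilter _ _) hc.continuousAt
  have hIc : Continuous fun r => ∫ q in r..s, c q :=
    continuous_iff_continuousAt.2 fun r => (hI r).continuousAt
  have hd : ∀ r, HasDerivAt (fun r => Real.exp (∫ q in r..s, c q) * E r)
      (Real.exp (∫ q in r..s, c q) * b r) r := by
    intro r
    refine ((hI r).exp.mul (hE r)).congr_deriv ?_
    ring
  have := intervalIntegral.integral_eq_sub_of_hasDerivAt (a := t) (b := s) (fun r _ => hd r)
    ((by fun_prop : Continuous fun r => Real.exp (∫ q in r..s, c q) * b r).intervalIntegrable _ _)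
  rw [this]
  simp

/-- The derivative of the flow in the space variable, written in closed form: `Q x x w` is the space
derivative of the velocity. -/
noncomputable def jac (Q : ℝ → ℝ → ℝ → ℝ) (W : ℝ → ℝ) (X : ℝ → ℝ → ℝ → ℝ) (s t x : ℝ) : ℝ :=
  Real.exp (∫ r in t..s, Q (X r t x) (X r t x) (W r))

section
variable {lam : ℝ → ℝ → ℝ} {M L c : ℝ} {v : ℝ → ℝ → ℝ} {Q : ℝ → ℝ → ℝ → ℝ} {W : ℝ → ℝ}
  {X : ℝ → ℝ → ℝ → ℝ}

lemma IsVelocityExtension.L_pos (hv : IsVelocityExtension lam M L c v Q) : 0 < L :=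
  hv.c_pos.trans_le (((hv.left 0).trans (le_abs_self _)).trans (hv.bound 0 0))

lemma IsVelocityExtension.exists_flow (hv : IsVelocityExtension lam M L c v Q)
    (hW : Continuous W) : ∃ X, IsFlow (fun s x => v x (W s)) X := by
  have h := exists_global_solution (b := fun s x => v x (W s)) (L := L)
    (hv.cont.comp (by fun_prop : Continuous fun z : ℝ × ℝ => (z.2, W z.1)))
    (fun t x => hv.bound _ _) (fun t x y => by
      rw [hv.slope, abs_mul]
      exact mul_le_mul_of_nonneg_right (hv.slope_bound _ _ _) (abs_nonneg _))
  choose γ h1 h2 using h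
  exact ⟨fun s t x => γ t x s, fun t x => h1 t x, fun s t x => h2 t x s⟩

lemma IsFlow.continuous_left {b : ℝ → ℝ → ℝ} (hX : IsFlow b X) (t x : ℝ) :
    Continuous fun s => X s t x :=
  continuous_iff_continuousAt.2 fun s => (hX.deriv s t x).continuousAt

/-- The exact formula for the difference of two characteristics; `X t' t x` is the point where the
second one starts when it coincides with the first. -/
lemma flow_sub (hv : IsVelocityExtension lam M L c v Q) (hW : Continuous W)
    (hX : IsFlow (fun s x => v x (W s)) X) (s t x t' x' : ℝ) :
    X s t' x' - X s t x =
      Real.exp (∫ r in t'..s, Q (X r t x) (X r t' x') (W r)) * (x' - X t' t x) := by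
  have h1 := hX.continuous_left t x
  have h2 := hX.continuous_left t' x'
  have hc : Continuous fun r => Q (X r t x) (X r t' x') (W r) :=
    hv.cont_slope.comp (f := fun r => (X r t x, X r t' x', W r)) (by fun_prop)
  have := linear_ode_solution (E := fun r => X r t' x' - X r t x) hc (b := fun _ => 0)
    continuous_const (fun r => by
      refine ((hX.deriv r t' x').sub (hX.deriv r t x)).congr_deriv ?_
      rw [hv.slope, add_zero]) t' s
  simpa [hX.init] using this

lemma abs_flow_sub_self_le (hv : IsVelocityExtension lam M L c v Q)
    (hX : IsFlow (fun s x => v x (W s)) X) (s s' t x : ℝ) :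
    |X s t x - X s' t x| ≤ L * |s - s'| := by
  have := Convex.norm_image_sub_le_of_norm_hasDerivWithin_le (f := fun s => X s t x)
    (s := univ) (C := L) (x := s') (y := s)
    (fun r _ => (hX.deriv r t x).hasDerivWithinAt) (fun r _ => hv.bound _ _) convex_univ
    (mem_univ _) (mem_univ _)
  simpa using this

lemma abs_integral_slope_le (hv : IsVelocityExtension lam M L c v Q) (f g h : ℝ → ℝ) (s t : ℝ) :
    |∫ r in t..s, Q (f r) (g r) (h r)| ≤ L * |s - t| := by
  rw [← Real.norm_eq_abs]
  exact intervalIntegral.norm_integral_le_of_norm_le_const fun _ _ => hv.slope_bound _ _ _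

lemma flow_continuous (hv : IsVelocityExtension lam M L c v Q) (hW : Continuous W)
    (hX : IsFlow (fun s x => v x (W s)) X) :
    Continuous fun z : ℝ × ℝ × ℝ => X z.1 z.2.1 z.2.2 := by
  rw [continuous_iff_continuousAt]
  rintro ⟨s, t, x⟩
  have hb : ∀ z : ℝ × ℝ × ℝ, ‖X z.1 z.2.1 z.2.2 - X s t x‖ ≤
      Real.exp (L * |s - z.2.1|) * (|z.2.2 - x| + L * |z.2.1 - t|) + L * |z.1 - s| := by
    rintro ⟨s', t', x'⟩
    have h1 := abs_flow_sub_self_le hv hX s' s t' x'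
    have h2 := flow_sub hv hW hX s t x t' x'
    have h3 := abs_flow_sub_self_le hv hX t' t t x
    rw [hX.init] at h3
    have h4 : |X s t' x' - X s t x| ≤ Real.exp (L * |s - t'|) * (|x' - x| + L * |t' - t|) := by
      rw [h2, abs_mul, Real.abs_exp]
      gcongr
      · exact (le_abs_self _).trans (abs_integral_slope_le hv _ _ _ _ _)
      · calc |x' - X t' t x| = |(x' - x) - (X t' t x - x)| := by ring_nf
          _ ≤ _ := (abs_sub _ _).trans (by gcongr)
    calc ‖X s' t' x' - X s t x‖ = |(X s t' x' - X s t x) + (X s' t' x' - X s t' x')| := by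
          rw [Real.norm_eq_abs]; ring_nf
      _ ≤ _ := (abs_add_le _ _).trans (by gcongr)
  refine tendsto_iff_norm_sub_tendsto_zero.2 (squeeze_zero (fun _ => norm_nonneg _) hb ?_)
  have : Continuous fun z : ℝ × ℝ × ℝ =>
      Real.exp (L * |s - z.2.1|) * (|z.2.2 - x| + L * |z.2.1 - t|) + L * |z.1 - s| := by fun_prop
  have h := this.tendsto (s, t, x)
  simpa using h

lemma jac_pos (s t x : ℝ) : 0 < jac Q W X s t x := Real.exp_pos _

lemma jac_le (hv : IsVelocityExtension lam M L c v Q) (s t x : ℝ) :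
    jac Q W X s t x ≤ Real.exp (L * |s - t|) :=
  Real.exp_le_exp.2 ((le_abs_self _).trans (abs_integral_slope_le hv _ _ _ _ _))

lemma le_jac (hv : IsVelocityExtension lam M L c v Q) (s t x : ℝ) :
    Real.exp (-(L * |s - t|)) ≤ jac Q W X s t x :=
  Real.exp_le_exp.2 (abs_le.1 (abs_integral_slope_le hv _ _ _ _ _)).1

lemma jac_continuous (hv : IsVelocityExtension lam M L c v Q) (hW : Continuous W)
    (hX : IsFlow (fun s x => v x (W s)) X) :
    Continuous fun z : ℝ × ℝ × ℝ => jac Q W X z.1 z.2.1 z.2.2 := by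
  have hXc := flow_continuous hv hW hX
  have hc : Continuous (Function.uncurry fun (z : ℝ × ℝ × ℝ) (r : ℝ) =>
      Q (X r z.2.1 z.2.2) (X r z.2.1 z.2.2) (W r)) := by
    have h1 : Continuous fun y : (ℝ × ℝ × ℝ) × ℝ => X y.2 y.1.2.1 y.1.2.2 :=
      hXc.comp (f := fun y : (ℝ × ℝ × ℝ) × ℝ => (y.2, y.1.2.1, y.1.2.2)) (by fun_prop)
    exact hv.cont_slope.comp (f := fun y : (ℝ × ℝ × ℝ) × ℝ =>
      (X y.2 y.1.2.1 y.1.2.2, X y.2 y.1.2.1 y.1.2.2, W y.2)) (by fun_prop)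
  unfold jac
  refine Real.continuous_exp.comp ?_
  have e : (fun z : ℝ × ℝ × ℝ => ∫ r in z.2.1..z.1, Q (X r z.2.1 z.2.2) (X r z.2.1 z.2.2) (W r)) =
      fun z => (∫ r in (0 : ℝ)..z.1, Q (X r z.2.1 z.2.2) (X r z.2.1 z.2.2) (W r)) -
        ∫ r in (0 : ℝ)..z.2.1, Q (X r z.2.1 z.2.2) (X r z.2.1 z.2.2) (W r) := by
    ext z
    have hz : Continuous fun r => Q (X r z.2.1 z.2.2) (X r z.2.1 z.2.2) (W r) :=
      hc.comp (by fun_prop : Continuous fun r : ℝ => (z, r))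
    rw [intervalIntegral.integral_interval_sub_left] <;> exact hz.intervalIntegrable _ _
  rw [e]
  exact (intervalIntegral.continuous_parametric_intervalIntegral_of_continuous hc (by fun_prop)).sub
    (intervalIntegral.continuous_parametric_intervalIntegral_of_continuous hc (by fun_prop))

/-- At a zero of `g`, the product `f * g` is differentiable even if `f` is only continuous. -/
lemma hasFDerivAt_mul_of_eq_zero {E : Type*} [NormedAddCommGroup E] [NormedSpace ℝ E]
    {f g : E → ℝ} {g' : E →L[ℝ] ℝ} {z : E} (hf : ContinuousAt f z) (hg : HasFDerivAt g g' z)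
    (h0 : g z = 0) : HasFDerivAt (fun y => f y * g y) (f z • g') z := by
  have h1 : (fun y => (f y - f z) * g y) =o[𝓝 z] fun y => y - z := by
    have ho : (fun y => f y - f z) =o[𝓝 z] fun _ => (1 : ℝ) :=
      (Asymptotics.isLittleO_one_iff ℝ).2 (by simpa using hf.tendsto.sub_const (f z))
    have hO : g =O[𝓝 z] fun y => y - z := by simpa [h0] using hg.isBigO_sub
    have := ho.mul_isBigO hO.norm_right
    simpa using this
  have h2 : HasFDerivAt (fun y => (f y - f z) * g y) (0 : E →L[ℝ] ℝ) z := by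
    refine HasFDerivAt.of_isLittleO ?_
    simpa [h0] using h1
  have h3 := h2.add (hg.const_mul (f z))
  simp only [zero_add] at h3
  refine h3.congr_of_eventuallyEq (Eventually.of_forall fun y => ?_)
  simp only [Pi.add_apply]
  ring

/-- In `flow_sub` the exponential is continuous in `(t', x')` and the other factor vanishes at
`(t, x)`, so differentiability does not require differentiating the exponential. -/
lemma flow_hasFDerivAt (hv : IsVelocityExtension lam M L c v Q) (hW : Continuous W)
    (hX : IsFlow (fun s x => v x (W s)) X) (s : ℝ) (z : ℝ × ℝ) :
    HasFDerivAt (fun z : ℝ × ℝ => X s z.1 z.2)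
      (jac Q W X s z.1 z.2 •
        (ContinuousLinearMap.snd ℝ ℝ ℝ - v z.2 (W z.1) • ContinuousLinearMap.fst ℝ ℝ ℝ)) z := by
  obtain ⟨t, x⟩ := z
  have hXc := flow_continuous hv hW hX
  have hg : HasFDerivAt (fun z : ℝ × ℝ => z.2 - X z.1 t x)
      (ContinuousLinearMap.snd ℝ ℝ ℝ - v x (W t) • ContinuousLinearMap.fst ℝ ℝ ℝ) (t, x) := by
    have h1 := hX.deriv t t x
    rw [hX.init] at h1
    have h2 := h1.comp_hasFDerivAt (t, x) (hasFDerivAt_fst (𝕜 := ℝ) (p := (t, x)))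
    exact hasFDerivAt_snd.sub h2
  have hf : Continuous fun z : ℝ × ℝ =>
      Real.exp (∫ r in z.1..s, Q (X r t x) (X r z.1 z.2) (W r)) := by
    refine Real.continuous_exp.comp ?_
    have hc : Continuous (Function.uncurry fun (z : ℝ × ℝ) (r : ℝ) =>
        Q (X r t x) (X r z.1 z.2) (W r)) := by
      have h1 : Continuous fun y : (ℝ × ℝ) × ℝ => X y.2 y.1.1 y.1.2 :=
        hXc.comp (f := fun y : (ℝ × ℝ) × ℝ => (y.2, y.1.1, y.1.2)) (by fun_prop)
      have h2 := hX.continuous_left t x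
      exact hv.cont_slope.comp (f := fun y : (ℝ × ℝ) × ℝ =>
        (X y.2 t x, X y.2 y.1.1 y.1.2, W y.2)) (by fun_prop)
    have := (intervalIntegral.continuous_parametric_intervalIntegral_of_continuous (μ := volume) (a₀ := s) hc
      (s := fun z : ℝ × ℝ => z.1) (by fun_prop)).neg
    refine this.congr fun z => ?_
    rw [intervalIntegral.integral_symm]
    rfl
  have h := hasFDerivAt_mul_of_eq_zero hf.continuousAt hg (by simp [hX.init])
  have h' := h.const_add (X s t x)
  refine h'.congr_of_eventuallyEq (Eventually.of_forall fun z => ?_)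
  simp only
  rw [← flow_sub hv hW hX s t x z.1 z.2]
  ring

lemma flow_hasDerivAt_space (hv : IsVelocityExtension lam M L c v Q) (hW : Continuous W)
    (hX : IsFlow (fun s x => v x (W s)) X) (s t x : ℝ) :
    HasDerivAt (fun x => X s t x) (jac Q W X s t x) x := by
  have h := (flow_hasFDerivAt hv hW hX s (t, x)).comp_hasDerivAt x
    ((hasDerivAt_const x t).prodMk (hasDerivAt_id x))
  refine h.congr_deriv ?_
  simp

lemma flow_hasDerivAt_time (hv : IsVelocityExtension lam M L c v Q) (hW : Continuous W)
    (hX : IsFlow (fun s x => v x (W s)) X) (s t x : ℝ) :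
    HasDerivAt (fun t => X s t x) (-(v x (W t) * jac Q W X s t x)) t := by
  have h := (flow_hasFDerivAt hv hW hX s (t, x)).comp_hasDerivAt t
    ((hasDerivAt_id t).prodMk (hasDerivAt_const t x))
  refine h.congr_deriv ?_
  simp
  ring

lemma flow_contDiff (hv : IsVelocityExtension lam M L c v Q) (hW : Continuous W)
    (hX : IsFlow (fun s x => v x (W s)) X) (s : ℝ) :
    ContDiff ℝ 1 fun z : ℝ × ℝ => X s z.1 z.2 := by
  rw [contDiff_one_iff_hasFDerivAt]
  refine ⟨_, ?_, flow_hasFDerivAt hv hW hX s⟩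
  have h1 : Continuous fun z : ℝ × ℝ => jac Q W X s z.1 z.2 :=
    (jac_continuous hv hW hX).comp (f := fun z : ℝ × ℝ => (s, z.1, z.2)) (by fun_prop)
  have h2 : Continuous fun z : ℝ × ℝ => v z.2 (W z.1) :=
    hv.cont.comp (f := fun z : ℝ × ℝ => (z.2, W z.1)) (by fun_prop)
  exact h1.smul (continuous_const.sub (h2.smul continuous_const))

/-- Characteristics cannot re-enter through `x = 1`, where the velocity is positive. -/
lemma one_le_flow (hv : IsVelocityExtension lam M L c v Q)
    (hX : IsFlow (fun s x => v x (W s)) X) {s t x : ℝ} (hts : t ≤ s) (hx : 1 ≤ x) :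
    1 ≤ X s t x := by
  refine image_le_of_deriv_right_lt_deriv_boundary' (f := fun _ => (1 : ℝ)) (f' := fun _ => 0)
    (B := fun s => X s t x) (B' := fun s => v (X s t x) (W s)) (a := t) (b := s)
    continuousOn_const (fun r _ => hasDerivWithinAt_const _ _ _) (by simpa [hX.init] using hx)
    (hX.continuous_left t x).continuousOn (fun r _ => (hX.deriv r t x).hasDerivWithinAt)
    (fun r _ h => ?_) ⟨hts, le_rfl⟩
  rw [← h]
  exact hv.right _

/-- Flows driven by two different mass functions, by variation of constants. -/
lemma abs_flow_sub_flow_le (hv : IsVelocityExtension lam M L c v Q) (hW : Continuous W)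
    (hX : IsFlow (fun s x => v x (W s)) X) {W' : ℝ → ℝ} {X' : ℝ → ℝ → ℝ → ℝ}
    (hW' : Continuous W') (hX' : IsFlow (fun s x => v x (W' s)) X') {s t : ℝ} (x : ℝ)
    (hts : t ≤ s) :
    |X' s t x - X s t x| ≤ L * Real.exp (L * (s - t)) * ∫ r in t..s, |W' r - W r| := by
  have h1 := hX.continuous_left t x
  have h2 := hX'.continuous_left t x
  have hc : Continuous fun r => Q (X r t x) (X' r t x) (W' r) :=
    hv.cont_slope.comp (f := fun r => (X r t x, X' r t x, W' r)) (by fun_prop)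
  have hb : Continuous fun r => v (X r t x) (W' r) - v (X r t x) (W r) :=
    (hv.cont.comp (f := fun r => (X r t x, W' r)) (by fun_prop)).sub
      (hv.cont.comp (f := fun r => (X r t x, W r)) (by fun_prop))
  have := linear_ode_solution (E := fun r => X' r t x - X r t x) hc hb (fun r => by
      refine ((hX'.deriv r t x).sub (hX.deriv r t x)).congr_deriv ?_
      rw [← hv.slope]
      ring) t s
  simp only [hX.init, hX'.init, sub_self, mul_zero, zero_add] at this
  rw [this, ← Real.norm_eq_abs, ← intervalIntegral.integral_const_mul]
  refine intervalIntegral.norm_integral_le_of_norm_le hts (Eventually.of_forall fun r hr => ?_)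
    ((by fun_prop : Continuous fun r =>
      L * Real.exp (L * (s - t)) * |W' r - W r|).intervalIntegrable _ _)
  have hL := hv.L_pos
  rw [norm_mul, Real.norm_eq_abs, Real.norm_eq_abs, Real.abs_exp]
  calc _ ≤ Real.exp (L * (s - t)) * (L * |W' r - W r|) := by
        gcongr
        · refine (le_abs_self _).trans ((abs_integral_slope_le hv _ _ _ _ _).trans ?_)
          rw [abs_of_nonneg (by linarith [hr.2])]
          gcongr
          exact hr.1.le
        · exact hv.lipschitz _ _ _
    _ = _ := by ring

end

/-! ### Representation of weak solutions along characteristics -/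

lemma leb_eq_restrict_Ioc (a b : ℝ) : leb a b = volume.restrict (Ioc a b) :=
  restrict_Ioo_eq_restrict_Ioc

lemma integral_leb {a b : ℝ} (hab : a ≤ b) (f : ℝ → ℝ) :
    ∫ x, f x ∂(leb a b) = ∫ x in a..b, f x := by
  rw [leb_eq_restrict_Ioc, intervalIntegral.integral_of_le hab]

lemma intervalIntegrable_iff_integrable_leb {a b : ℝ} (hab : a ≤ b) {f : ℝ → ℝ} :
    IntervalIntegrable f volume a b ↔ Integrable f (leb a b) := by
  rw [leb_eq_restrict_Ioc, intervalIntegrable_iff_integrableOn_Ioc_of_le hab, IntegrableOn]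

lemma eLpNorm_one_leb {a b : ℝ} (hab : a ≤ b) {f : ℝ → ℝ} (hf : Integrable f (leb a b)) :
    eLpNorm f 1 (leb a b) = ENNReal.ofReal (∫ x in a..b, |f x|) := by
  rw [eLpNorm_one_eq_lintegral_enorm, ← ofReal_integral_norm_eq_lintegral_enorm hf,
    integral_leb hab]
  rfl

lemma abs_integral_mul_le {a b C : ℝ} (hab : a ≤ b) {f g : ℝ → ℝ}
    (hf : IntervalIntegrable f volume a b) (hg : ∀ x ∈ Icc a b, |g x| ≤ C) :
    |∫ x in a..b, f x * g x| ≤ C * ∫ x in a..b, |f x| := by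
  rw [← Real.norm_eq_abs, ← intervalIntegral.integral_const_mul]
  refine intervalIntegral.norm_integral_le_of_norm_le hab (Eventually.of_forall fun x hx => ?_)
    (hf.abs.const_mul C)
  rw [norm_mul, Real.norm_eq_abs, Real.norm_eq_abs, mul_comm]
  exact mul_le_mul_of_nonneg_right (hg x ⟨hx.1.le, hx.2⟩) (abs_nonneg _)

namespace IsWeakSolution
variable {lam : ℝ → ℝ → ℝ} {T : ℝ} {rho0 u : ℝ → ℝ} {rho : ℝ → ℝ → ℝ}

lemma intervalIntegrable (h : IsWeakSolution lam T rho0 u rho) {t : ℝ} (ht : t ∈ Icc 0 T) :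
    IntervalIntegrable (rho t) volume 0 1 :=
  (intervalIntegrable_iff_integrable_leb zero_le_one).2 ((memLp_one_iff_integrable).1 (h.memLp_one t ht))

lemma tendsto_integral_abs_sub (h : IsWeakSolution lam T rho0 u rho) {s : ℝ} (hs : s ∈ Icc 0 T) :
    Tendsto (fun t => ∫ x in (0 : ℝ)..1, |rho t x - rho s x|) (𝓝[Icc 0 T] s) (𝓝 0) := by
  have h1 := (ENNReal.tendsto_toReal ENNReal.zero_ne_top).comp (h.continuous_L1 s hs)
  refine h1.congr' ?_
  filter_upwards [self_mem_nhdsWithin] with t ht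
  have hi : Integrable (fun x => rho t x - rho s x) (leb 0 1) :=
    (intervalIntegrable_iff_integrable_leb zero_le_one).1
      ((h.intervalIntegrable ht).sub (h.intervalIntegrable hs))
  simp only [Function.comp]
  rw [eLpNorm_one_leb zero_le_one hi, ENNReal.toReal_ofReal]
  exact intervalIntegral.integral_nonneg zero_le_one fun _ _ => abs_nonneg _

/-- Continuity in time of the pairing with a continuous function, from continuity in `L¹`. -/
lemma continuousOn_pairing (h : IsWeakSolution lam T rho0 u rho) {G : ℝ → ℝ → ℝ}
    (hG : Continuous fun z : ℝ × ℝ => G z.1 z.2) :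
    ContinuousOn (fun t => ∫ x in (0 : ℝ)..1, rho t x * G t x) (Icc 0 T) := by
  intro s hs
  have hGt : ∀ t, Continuous (G t) := fun t =>
    hG.comp (f := fun x : ℝ => (t, x)) (by fun_prop)
  have hGx : ∀ x, Continuous fun t => G t x := fun x =>
    hG.comp (f := fun t : ℝ => (t, x)) (by fun_prop)
  obtain ⟨C, hC⟩ := (isCompact_Icc.prod isCompact_Icc :
    IsCompact (Icc 0 T ×ˢ Icc (0 : ℝ) 1)).exists_bound_of_continuousOn hG.continuousOn
  have hC' : ∀ t ∈ Icc 0 T, ∀ x ∈ Icc (0 : ℝ) 1, |G t x| ≤ C := fun t ht x hx =>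
    hC (t, x) ⟨ht, hx⟩
  have h2 : Tendsto (fun t => ∫ x in (0 : ℝ)..1, rho s x * G t x) (𝓝[Icc 0 T] s)
      (𝓝 (∫ x in (0 : ℝ)..1, rho s x * G s x)) := by
    refine intervalIntegral.tendsto_integral_filter_of_dominated_convergence
      (fun x => C * |rho s x|) ?_ ?_ ((h.intervalIntegrable hs).abs.const_mul C) ?_
    · refine Eventually.of_forall fun t => ?_
      exact ((h.intervalIntegrable hs).mul_continuousOn (hGt t).continuousOn).def'.aestronglyMeasurable
    · filter_upwards [self_mem_nhdsWithin] with t ht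
      refine Eventually.of_forall fun x hx => ?_
      rw [uIoc_of_le zero_le_one] at hx
      rw [norm_mul, Real.norm_eq_abs, Real.norm_eq_abs, mul_comm]
      exact mul_le_mul_of_nonneg_right (hC' t ht x ⟨hx.1.le, hx.2⟩) (abs_nonneg _)
    · refine Eventually.of_forall fun x _ => ?_
      exact (tendsto_const_nhds.mul ((hGx x).tendsto s)).mono_left nhdsWithin_le_nhds
  have h1 : Tendsto (fun t => ∫ x in (0 : ℝ)..1, (rho t x - rho s x) * G t x) (𝓝[Icc 0 T] s)
      (𝓝 0) := by
    refine squeeze_zero_norm' ?_ (by simpa using (h.tendsto_integral_abs_sub hs).const_mul C)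
    filter_upwards [self_mem_nhdsWithin] with t ht
    exact abs_integral_mul_le zero_le_one
      ((h.intervalIntegrable ht).sub (h.intervalIntegrable hs)) (hC' t ht)
  have h3 := h1.add h2
  rw [zero_add] at h3
  refine h3.congr' ?_
  filter_upwards [self_mem_nhdsWithin] with t ht
  rw [← intervalIntegral.integral_add]
  · congr 1
    ext x
    ring
  · exact ((h.intervalIntegrable ht).sub (h.intervalIntegrable hs)).mul_continuousOn
      (hGt t).continuousOn
  · exact (h.intervalIntegrable hs).mul_continuousOn (hGt t).continuousOn

lemma continuousOn_mass (h : IsWeakSolution lam T rho0 u rho) :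
    ContinuousOn (mass rho) (Icc 0 T) := by
  have := h.continuousOn_pairing (G := fun _ _ => 1) continuous_const
  simp only [mul_one] at this
  exact this

end IsWeakSolution

/-- A `C^1` function of time that vanishes at `τ` and tends to `1` on `[0, τ)`. -/
noncomputable def timeCutoff (τ : ℝ) (n : ℕ) (t : ℝ) : ℝ := 1 - (t / τ) ^ (n + 1)

lemma hasDerivAt_timeCutoff (τ : ℝ) (n : ℕ) (t : ℝ) :
    HasDerivAt (timeCutoff τ n) (-((n + 1) / τ * (t / τ) ^ n)) t := by
  have := (((hasDerivAt_id t).div_const τ).pow (n + 1)).const_sub 1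
  refine this.congr_deriv ?_
  simp
  ring

/-- The derivatives of the time cutoffs converge to minus the Dirac mass at `τ`. -/
lemma tendsto_integral_timeCutoff {τ : ℝ} (hτ : 0 < τ) {m : ℝ → ℝ}
    (hm : ContinuousOn m (Icc 0 τ)) :
    Tendsto (fun n : ℕ => ∫ t in (0 : ℝ)..τ, -((n + 1) / τ * (t / τ) ^ n) * m t) atTop
      (𝓝 (-m τ)) := by
  have h := tendsto_setIntegral_pow_smul_of_unique_maximum_of_isCompact_of_continuousOn
    (μ := volume) (s := Icc 0 τ) (c := fun t => t / τ) (x₀ := τ) (g := m) isCompact_Icc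
    (by fun_prop) (fun y hy hne => by
      have : y < τ := lt_of_le_of_ne hy.2 hne
      exact div_lt_div_of_pos_right this hτ) (fun x hx => div_nonneg hx.1 hτ.le)
    (by rw [div_self hτ.ne']; exact one_pos)
    (by rw [interior_Icc, closure_Ioo hτ.ne]; exact ⟨hτ.le, le_rfl⟩) hm
  refine (h.neg).congr fun n => ?_
  have e1 : ∫ x in Icc 0 τ, (x / τ) ^ n = τ / (n + 1) := by
    rw [integral_Icc_eq_integral_Ioc, ← intervalIntegral.integral_of_le hτ.le]
    rw [intervalIntegral.integral_comp_div (fun y : ℝ => y ^ n) hτ.ne', integral_pow]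
    simp [hτ.ne']
    ring
  rw [e1, integral_Icc_eq_integral_Ioc, ← intervalIntegral.integral_of_le hτ.le, smul_eq_mul,
    inv_div, ← neg_mul, ← intervalIntegral.integral_const_mul]
  congr 1
  ext t
  simp only [smul_eq_mul]
  ring

section
variable {lam : ℝ → ℝ → ℝ} {M L c : ℝ} {v : ℝ → ℝ → ℝ} {Q : ℝ → ℝ → ℝ → ℝ} {W : ℝ → ℝ}
  {X : ℝ → ℝ → ℝ → ℝ} {T : ℝ} {rho0 u : ℝ → ℝ} {rho : ℝ → ℝ → ℝ}

lemma isTest_flow (hv : IsVelocityExtension lam M L c v Q) (hW : Continuous W)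
    (hX : IsFlow (fun s x => v x (W s)) X) {F : ℝ → ℝ} (hF : ContDiff ℝ 1 F)
    (hF1 : ∀ x, 1 ≤ x → F x = 0) {τ : ℝ} (hτ : 0 < τ) (n : ℕ) :
    IsTest τ fun t x => timeCutoff τ n t * F (X τ t x) where
  contDiffOn := by
    have h1 : ContDiff ℝ 1 fun z : ℝ × ℝ => F (X τ z.1 z.2) := hF.comp (flow_contDiff hv hW hX τ)
    have h2 : ContDiff ℝ 1 fun z : ℝ × ℝ => timeCutoff τ n z.1 := by
      unfold timeCutoff; fun_prop
    exact (h2.mul h1).contDiffOn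
  final := fun x _ => by simp [timeCutoff, div_self hτ.ne']
  right := fun t ht => by simp [hF1 _ (one_le_flow hv hX ht.2 le_rfl)]

/-- `F (X τ t x)` is constant along characteristics, so only the derivative of the time cutoff
survives in the weak form. -/
lemma integral_mul_test_flow (hv : IsVelocityExtension lam M L c v Q) (hW : Continuous W)
    (hX : IsFlow (fun s x => v x (W s)) X)
    (hWeq : ∀ t ∈ Icc 0 T, W t = mass rho t) (hWM : ∀ t ∈ Icc 0 T, W t ∈ Icc 0 M)
    {F : ℝ → ℝ} (hF : ContDiff ℝ 1 F) {τ : ℝ} (hτ : 0 < τ) (hτT : τ ≤ T) (n : ℕ) {t : ℝ}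
    (ht : t ∈ Icc 0 τ) :
    ∫ x in (0 : ℝ)..1, rho t x *
      (derivWithin (fun s => timeCutoff τ n s * F (X τ s x)) (Icc 0 τ) t
        + lam x (mass rho t) *
          derivWithin (fun y => timeCutoff τ n t * F (X τ t y)) (Icc 0 1) x)
    = -((n + 1) / τ * (t / τ) ^ n) * ∫ x in (0 : ℝ)..1, rho t x * F (X τ t x) := by
  rw [← intervalIntegral.integral_const_mul]
  refine intervalIntegral.integral_congr fun x hx => ?_
  rw [uIcc_of_le zero_le_one] at hx
  have htT : t ∈ Icc 0 T := ⟨ht.1, ht.2.trans hτT⟩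
  have hFd : HasDerivAt F (deriv F (X τ t x)) (X τ t x) :=
    (hF.differentiable one_ne_zero _).hasDerivAt
  have h1 := ((hasDerivAt_timeCutoff τ n t).mul
    (hFd.comp t (flow_hasDerivAt_time hv hW hX τ t x))).hasDerivWithinAt (s := Icc 0 τ)
  have h2 := ((hFd.comp x (flow_hasDerivAt_space hv hW hX τ t x)).const_mul
    (timeCutoff τ n t)).hasDerivWithinAt (s := Icc 0 1)
  have e1 := h1.derivWithin (uniqueDiffOn_Icc hτ t ht)
  have e2 := h2.derivWithin (uniqueDiffOn_Icc zero_lt_one x hx)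
  have e3 : derivWithin (fun s => timeCutoff τ n s * F (X τ s x)) (Icc 0 τ) t = _ := e1
  have e4 : derivWithin (fun y => timeCutoff τ n t * F (X τ t y)) (Icc 0 1) x = _ := e2
  rw [e3, e4, ← hWeq t htT, ← hv.eq x hx _ (hWM t htT)]
  simp only [Function.comp]
  ring

/-- The mass at time `τ`, tested against `F`, is the initial mass and the mass that entered through
`x = 0`, both transported to time `τ` by the flow. -/
theorem weak_representation (hv : IsVelocityExtension lam M L c v Q) (hW : Continuous W)
    (hX : IsFlow (fun s x => v x (W s)) X) (hsol : IsWeakSolution lam T rho0 u rho)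
    (hu : IntervalIntegrable u volume 0 T)
    (hWeq : ∀ t ∈ Icc 0 T, W t = mass rho t) (hWM : ∀ t ∈ Icc 0 T, W t ∈ Icc 0 M)
    {F : ℝ → ℝ} (hF : ContDiff ℝ 1 F) (hF1 : ∀ x, 1 ≤ x → F x = 0)
    {τ : ℝ} (hτ : 0 < τ) (hτT : τ ≤ T) :
    ∫ x in (0 : ℝ)..1, rho τ x * F x =
      (∫ x in (0 : ℝ)..1, rho0 x * F (X τ 0 x)) + ∫ t in (0 : ℝ)..τ, u t * F (X τ t 0) := by
  have hXτ : Continuous fun z : ℝ × ℝ => X τ z.1 z.2 := (flow_contDiff hv hW hX τ).continuous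
  have hu' : IntervalIntegrable u volume 0 τ :=
    hu.mono_set (by rw [uIcc_of_le hτ.le, uIcc_of_le (hτ.le.trans hτT)]
                    exact Icc_subset_Icc_right hτT)
  have hm : ContinuousOn (fun t => ∫ x in (0 : ℝ)..1, rho t x * F (X τ t x)) (Icc 0 τ) :=
    (hsol.continuousOn_pairing (G := fun t x => F (X τ t x)) (hF.continuous.comp hXτ)).mono
      (Icc_subset_Icc_right hτT)
  have h1 := tendsto_integral_timeCutoff hτ hm
  simp only [hX.init] at h1
  have hc : Continuous fun t => F (X τ t 0) :=
    hF.continuous.comp (hXτ.comp (f := fun t : ℝ => (t, (0 : ℝ))) (by fun_prop))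
  have hi : IntervalIntegrable (fun t => u t * F (X τ t 0)) volume 0 τ :=
    hu'.mul_continuousOn hc.continuousOn
  have h2 : Tendsto (fun n : ℕ => ∫ t in (0 : ℝ)..τ, u t * (timeCutoff τ n t * F (X τ t 0))) atTop
      (𝓝 (∫ t in (0 : ℝ)..τ, u t * F (X τ t 0))) := by
    refine intervalIntegral.tendsto_integral_filter_of_dominated_convergence
      (fun t => |u t * F (X τ t 0)|) ?_ ?_ hi.abs ?_
    · refine Eventually.of_forall fun n => ?_
      have hct : Continuous fun t => timeCutoff τ n t * F (X τ t 0) := by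
        refine Continuous.mul ?_ hc
        unfold timeCutoff; fun_prop
      exact (hu'.mul_continuousOn hct.continuousOn).def'.aestronglyMeasurable
    · refine Eventually.of_forall fun n => Eventually.of_forall fun t ht => ?_
      rw [uIoc_of_le hτ.le] at ht
      have h0 : 0 ≤ t / τ := div_nonneg ht.1.le hτ.le
      have h1 : t / τ ≤ 1 := (div_le_one hτ).2 ht.2
      have h2 : |timeCutoff τ n t| ≤ 1 := by
        have h3 : (t / τ) ^ (n + 1) ≤ 1 := pow_le_one₀ h0 h1
        have h4 : 0 ≤ (t / τ) ^ (n + 1) := by positivity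
        rw [timeCutoff, abs_le]
        constructor <;> linarith
      rw [Real.norm_eq_abs]
      calc |u t * (timeCutoff τ n t * F (X τ t 0))|
          = |timeCutoff τ n t| * |u t * F (X τ t 0)| := by rw [← abs_mul]; ring_nf
        _ ≤ 1 * |u t * F (X τ t 0)| := by gcongr
        _ = _ := one_mul _
    · have hne : ∀ᵐ t : ℝ, t ≠ τ := by
        simp [ae_iff, measure_singleton]
      filter_upwards [hne] with t hne ht
      rw [uIoc_of_le hτ.le] at ht
      have h0 : 0 ≤ t / τ := div_nonneg ht.1.le hτ.le
      have h1 : t / τ < 1 := (div_lt_one hτ).2 (lt_of_le_of_ne ht.2 hne)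
      have h3 : Tendsto (fun n : ℕ => timeCutoff τ n t) atTop (𝓝 1) := by
        have := ((tendsto_pow_atTop_nhds_zero_of_lt_one h0 h1).comp (tendsto_add_atTop_nat 1)).const_sub 1
        simpa [timeCutoff] using this
      have := (h3.mul_const (F (X τ t 0))).const_mul (u t)
      simpa using this
  have h3 := (h1.add h2).add_const (∫ x in (0 : ℝ)..1, rho0 x * F (X τ 0 x))
  have h4 : ∀ n : ℕ, (∫ t in (0 : ℝ)..τ, -((n + 1) / τ * (t / τ) ^ n) *
      ∫ x in (0 : ℝ)..1, rho t x * F (X τ t x)) +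
      (∫ t in (0 : ℝ)..τ, u t * (timeCutoff τ n t * F (X τ t 0))) +
      (∫ x in (0 : ℝ)..1, rho0 x * F (X τ 0 x)) = 0 := by
    intro n
    have := hsol.weak_form τ ⟨hτ.le, hτT⟩ _ (isTest_flow hv hW hX hF hF1 hτ n)
    have h0 : timeCutoff τ n 0 = 1 := by simp [timeCutoff]
    simp only [h0, one_mul] at this
    rw [intervalIntegral.integral_congr fun t ht => integral_mul_test_flow hv hW hX hWeq hWM hF hτ
      hτT n (uIcc_of_le hτ.le ▸ ht)] at this
    exact this
  simp only [h4] at h3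
  have := tendsto_nhds_unique h3 tendsto_const_nhds
  linarith

end

/-! ### Integrals composed with two nearby flows -/

/-- If `z'` stays `δ`-close to the strictly monotone `z`, then `F ∘ z'` lies between `F (z + δ)` and
`F (z - δ)` for antitone `F`, and these are close in `L¹` after the change of variables `y = z x`.
The sign `σ` is that of the derivative `N` of `z`. -/
lemma integral_abs_comp_sub_comp_le {a b δ κ σ : ℝ} (hab : a ≤ b) (hκ : 0 < κ) {F z z' N : ℝ → ℝ}
    (hF : Continuous F) (hanti : Antitone F) (h01 : ∀ x, F x ∈ Icc (0 : ℝ) 1)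
    (hz' : Continuous z') (hN : Continuous N) (hz : ∀ x, HasDerivAt z (N x) x)
    (hσ : |σ| = 1) (hNκ : ∀ x ∈ Icc a b, κ ≤ σ * N x) (hδ : ∀ x ∈ Icc a b, |z' x - z x| ≤ δ) :
    ∫ x in a..b, |F (z' x) - F (z x)| ≤ 2 * δ / κ := by
  have hδ0 : 0 ≤ δ := (abs_nonneg _).trans (hδ a ⟨le_rfl, hab⟩)
  have hzc : Continuous z := continuous_iff_continuousAt.2 fun x => (hz x).continuousAt
  have hi : ∀ p q, IntervalIntegrable F volume p q := fun p q => hF.intervalIntegrable p q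
  have hsub : ∀ e : ℝ, ∫ x in a..b, F (z x + e) * N x = ∫ y in (z a + e)..(z b + e), F y :=
    fun e => intervalIntegral.integral_comp_mul_deriv (f := fun x => z x + e) (f' := N) (g := F)
      (fun x _ => (hz x).add_const e) hN.continuousOn hF
  have hstep : ∀ p : ℝ, ∫ y in (p - δ)..(p + δ), F y ∈ Icc 0 (2 * δ) := by
    intro p
    constructor
    · exact intervalIntegral.integral_nonneg (by linarith) fun y _ => (h01 y).1
    · calc ∫ y in (p - δ)..(p + δ), F y ≤ ∫ y in (p - δ)..(p + δ), (1 : ℝ) :=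
            intervalIntegral.integral_mono (by linarith) (hi _ _) (by simp) fun y => (h01 y).2
        _ = 2 * δ := by simp; ring
  rw [le_div_iff₀ hκ, mul_comm, ← intervalIntegral.integral_const_mul]
  calc ∫ x in a..b, κ * |F (z' x) - F (z x)|
      ≤ ∫ x in a..b, σ * (F (z x + -δ) * N x - F (z x + δ) * N x) := by
        refine intervalIntegral.integral_mono_on hab
          ((by fun_prop : Continuous _).intervalIntegrable _ _)
          ((by fun_prop : Continuous _).intervalIntegrable _ _) fun x hx => ?_
        have hd := abs_le.1 (hδ x hx)
        have h1 : F (z x + δ) ≤ F (z' x) := hanti (by linarith)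
        have h2 : F (z' x) ≤ F (z x + -δ) := hanti (by linarith)
        have h3 : F (z x + δ) ≤ F (z x) := hanti (by linarith)
        have h4 : F (z x) ≤ F (z x + -δ) := hanti (by linarith)
        have h5 : |F (z' x) - F (z x)| ≤ F (z x + -δ) - F (z x + δ) := by
          rw [abs_le]; constructor <;> linarith
        calc κ * |F (z' x) - F (z x)| ≤ σ * N x * (F (z x + -δ) - F (z x + δ)) :=
              mul_le_mul (hNκ x hx) h5 (abs_nonneg _) (hκ.le.trans (hNκ x hx))
          _ = _ := by ring
    _ = σ * ((∫ y in (z a - δ)..(z a + δ), F y) - ∫ y in (z b - δ)..(z b + δ), F y) := by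
        rw [intervalIntegral.integral_const_mul, intervalIntegral.integral_sub
          ((by fun_prop : Continuous _).intervalIntegrable _ _)
          ((by fun_prop : Continuous _).intervalIntegrable _ _), hsub, hsub]
        have e1 := intervalIntegral.integral_add_adjacent_intervals (hi (z a + -δ) (z a + δ))
          (hi (z a + δ) (z b + δ))
        have e2 := intervalIntegral.integral_add_adjacent_intervals (hi (z a + -δ) (z b + -δ))
          (hi (z b + -δ) (z b + δ))
        simp only [sub_eq_add_neg]
        congr 1
        linarith
    _ ≤ |σ| * |(∫ y in (z a - δ)..(z a + δ), F y) - ∫ y in (z b - δ)..(z b + δ), F y| := by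
        rw [← abs_mul]; exact le_abs_self _
    _ ≤ 1 * (2 * δ) := by
        rw [hσ]
        gcongr
        have h1 := hstep (z a)
        have h2 := hstep (z b)
        rw [abs_le]
        constructor <;> linarith [h1.1, h1.2, h2.1, h2.2]
    _ = 2 * δ := one_mul _

/-- Integration by parts against a factor `k` that is only continuous, with the modulus of continuity
`ω` at scale `s`. -/
lemma abs_integral_mul_deriv_le {a b s B ω A η : ℝ} (hab : a ≤ b) (hs : 0 < s) {k G G' : ℝ → ℝ}
    (hk : Continuous k) (hkB : ∀ x ∈ Icc a (b + s), |k x| ≤ B)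
    (hkω : ∀ x ∈ Icc a b, ∀ y ∈ Icc x (x + s), |k y - k x| ≤ ω)
    (hG : ∀ x, HasDerivAt G (G' x) x) (hG' : Continuous G')
    (hGη : ∀ x ∈ Icc a b, |G x| ≤ η) (hGA : ∀ x ∈ Icc a b, |G' x| ≤ A) :
    |∫ x in a..b, k x * G' x| ≤ ω * A * (b - a) + (2 * B + 2 * B / s * (b - a)) * η := by
  have hGc : Continuous G := continuous_iff_continuousAt.2 fun x => (hG x).continuousAt
  have hmem : a ∈ Icc a b := ⟨le_rfl, hab⟩
  have hmem' : b ∈ Icc a b := ⟨hab, le_rfl⟩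
  have hη0 : 0 ≤ η := (abs_nonneg _).trans (hGη a hmem)
  have hA0 : 0 ≤ A := (abs_nonneg _).trans (hGA a hmem)
  have hB0 : 0 ≤ B := (abs_nonneg _).trans (hkB a ⟨le_rfl, by linarith⟩)
  have hω0 : 0 ≤ ω := (abs_nonneg _).trans (hkω a hmem a ⟨le_rfl, by linarith⟩)
  -- Steklov average of `k`
  set m : ℝ → ℝ := fun x => s⁻¹ * ∫ y in x..(x + s), k y with hm
  have hmd : ∀ x, HasDerivAt m (s⁻¹ * (k (x + s) - k x)) x := by
    intro x
    have h1 : ∀ x, HasDerivAt (fun x => ∫ y in (0 : ℝ)..x, k y) (k x) x := fun x =>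
      intervalIntegral.integral_hasDerivAt_right (hk.intervalIntegrable _ _)
        (hk.stronglyMeasurableAtFilter _ _) hk.continuousAt
    have h2 := (((h1 (x + s)).comp_add_const x s).sub (h1 x)).const_mul s⁻¹
    refine h2.congr_of_eventuallyEq (Eventually.of_forall fun y => ?_)
    simp only [hm, Pi.sub_apply]
    rw [intervalIntegral.integral_interval_sub_left] <;> exact hk.intervalIntegrable _ _
  have hmc : Continuous m := continuous_iff_continuousAt.2 fun x => (hmd x).continuousAt
  have hmB : ∀ x ∈ Icc a b, |m x| ≤ B := by
    intro x hx
    have h1 : ‖∫ y in x..(x + s), k y‖ ≤ B * |x + s - x| :=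
      intervalIntegral.norm_integral_le_of_norm_le_const fun y hy => by
        rw [uIoc_of_le (by linarith)] at hy
        exact hkB y ⟨hx.1.trans hy.1.le, by linarith [hy.2, hx.2]⟩
    rw [add_sub_cancel_left, abs_of_pos hs, Real.norm_eq_abs] at h1
    rw [hm, abs_mul, abs_of_pos (inv_pos.2 hs), inv_mul_le_iff₀ hs, mul_comm]
    exact h1
  have hmω : ∀ x ∈ Icc a b, |k x - m x| ≤ ω := by
    intro x hx
    have h1 : ‖∫ y in x..(x + s), (k y - k x)‖ ≤ ω * |x + s - x| :=
      intervalIntegral.norm_integral_le_of_norm_le_const fun y hy => by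
        rw [uIoc_of_le (by linarith)] at hy
        exact hkω x hx y ⟨hy.1.le, hy.2⟩
    rw [intervalIntegral.integral_sub (hk.intervalIntegrable _ _) (by simp),
      intervalIntegral.integral_const, add_sub_cancel_left, abs_of_pos hs, Real.norm_eq_abs,
      smul_eq_mul] at h1
    have e : k x - m x = -(s⁻¹ * ((∫ y in x..(x + s), k y) - s * k x)) := by
      simp only [hm]
      field_simp
      ring
    rw [e, abs_neg, abs_mul, abs_of_pos (inv_pos.2 hs), inv_mul_le_iff₀ hs, mul_comm s ω]
    exact h1
  have h1 : |∫ x in a..b, (k x - m x) * G' x| ≤ ω * A * (b - a) := by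
    have := intervalIntegral.norm_integral_le_of_norm_le_const (a := a) (b := b) (C := ω * A)
      (f := fun x => (k x - m x) * G' x) (fun x hx => by
        rw [uIoc_of_le hab] at hx
        have hx' : x ∈ Icc a b := ⟨hx.1.le, hx.2⟩
        rw [norm_mul]
        exact mul_le_mul (hmω x hx') (hGA x hx') (abs_nonneg _) hω0)
    rwa [abs_of_nonneg (by linarith : 0 ≤ b - a)] at this
  have h2 : ∫ x in a..b, m x * G' x =
      m b * G b - m a * G a - ∫ x in a..b, s⁻¹ * (k (x + s) - k x) * G x :=
    intervalIntegral.integral_mul_deriv_eq_deriv_mul (fun x _ => hmd x) (fun x _ => hG x)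
      ((by fun_prop : Continuous _).intervalIntegrable _ _) (hG'.intervalIntegrable _ _)
  have h3 : |∫ x in a..b, s⁻¹ * (k (x + s) - k x) * G x| ≤ 2 * B / s * η * (b - a) := by
    have := intervalIntegral.norm_integral_le_of_norm_le_const (a := a) (b := b)
      (C := 2 * B / s * η) (f := fun x => s⁻¹ * (k (x + s) - k x) * G x) (fun x hx => by
        rw [uIoc_of_le hab] at hx
        have hx' : x ∈ Icc a b := ⟨hx.1.le, hx.2⟩
        have hb1 := hkB x ⟨hx'.1, by linarith [hx'.2]⟩
        have hb2 := hkB (x + s) ⟨by linarith [hx'.1], by linarith [hx'.2]⟩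
        rw [norm_mul, norm_mul, Real.norm_eq_abs, Real.norm_eq_abs, Real.norm_eq_abs,
          abs_of_pos (inv_pos.2 hs)]
        have hb3 : |k (x + s) - k x| ≤ 2 * B := (abs_sub _ _).trans (by linarith)
        calc s⁻¹ * |k (x + s) - k x| * |G x| ≤ s⁻¹ * (2 * B) * η := by
              gcongr
              exact hGη x hx'
          _ = _ := by ring)
    rwa [abs_of_nonneg (by linarith : 0 ≤ b - a)] at this
  have h4 : ∀ x ∈ Icc a b, |m x * G x| ≤ B * η := fun x hx => by
    rw [abs_mul]
    exact mul_le_mul (hmB x hx) (hGη x hx) (abs_nonneg _) hB0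
  have h5 : ∫ x in a..b, k x * G' x =
      (∫ x in a..b, (k x - m x) * G' x) + ∫ x in a..b, m x * G' x := by
    rw [← intervalIntegral.integral_add ((by fun_prop : Continuous _).intervalIntegrable _ _)
      ((by fun_prop : Continuous _).intervalIntegrable _ _)]
    congr 1
    ext x
    ring
  rw [h5, h2]
  have h6 := abs_le.1 (h4 a hmem)
  have h7 := abs_le.1 (h4 b hmem')
  have h8 := abs_le.1 h1
  have h9 := abs_le.1 h3
  have e : (2 * B + 2 * B / s * (b - a)) * η = 2 * (B * η) + 2 * B / s * η * (b - a) := by ring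
  rw [e, abs_le]
  constructor <;> linarith

/-- The bound does not involve the modulus of continuity of `F`: on the change of variables given by
`z` and `z'` the difference becomes the derivative of a primitive of `F` along `z` and `z'`. -/
lemma abs_integral_mul_comp_sub_comp_le {a b s B ω A δ κ : ℝ} (hab : a ≤ b) (hs : 0 < s)
    {F g z z' N N' : ℝ → ℝ} (hF : Continuous F) (hF1 : ∀ x, |F x| ≤ 1) (hg : Continuous g)
    (hz : ∀ x, HasDerivAt z (N x) x) (hz' : ∀ x, HasDerivAt z' (N' x) x)
    (hN : Continuous N) (hN' : Continuous N') (hN0 : ∀ x, N x ≠ 0)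
    (hkB : ∀ x ∈ Icc a (b + s), |g x / N x| ≤ B)
    (hkω : ∀ x ∈ Icc a b, ∀ y ∈ Icc x (x + s), |g y / N y - g x / N x| ≤ ω)
    (hNA : ∀ x ∈ Icc a b, |N x| ≤ A) (hNA' : ∀ x ∈ Icc a b, |N' x| ≤ A)
    (hδ : ∀ x ∈ Icc a b, |z' x - z x| ≤ δ) (hκ : ∀ x ∈ Icc a b, |N' x - N x| ≤ κ) :
    |∫ x in a..b, g x * (F (z' x) - F (z x))| ≤
      ω * (2 * A) * (b - a) + (2 * B + 2 * B / s * (b - a)) * δ + B * κ * (b - a) := by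
  have hzc : Continuous z := continuous_iff_continuousAt.2 fun x => (hz x).continuousAt
  have hzc' : Continuous z' := continuous_iff_continuousAt.2 fun x => (hz' x).continuousAt
  have hk : Continuous fun x => g x / N x := hg.div hN hN0
  have hprim : ∀ x, HasDerivAt (fun x => ∫ y in (0 : ℝ)..x, F y) (F x) x := fun x =>
    intervalIntegral.integral_hasDerivAt_right (hF.intervalIntegrable _ _)
      (hF.stronglyMeasurableAtFilter _ _) hF.continuousAt
  have h1 := abs_integral_mul_deriv_le hab hs (k := fun x => g x / N x)
    (G := fun x => (∫ y in (0 : ℝ)..(z' x), F y) - ∫ y in (0 : ℝ)..(z x), F y)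
    (G' := fun x => F (z' x) * N' x - F (z x) * N x) (A := 2 * A) (η := δ) hk hkB hkω
    (fun x => ((hprim (z' x)).comp x (hz' x)).sub ((hprim (z x)).comp x (hz x)))
    (by fun_prop) (fun x hx => by
      rw [intervalIntegral.integral_interval_sub_left (hF.intervalIntegrable _ _)
        (hF.intervalIntegrable _ _), ← Real.norm_eq_abs]
      refine (intervalIntegral.norm_integral_le_of_norm_le_const fun y _ => hF1 y).trans ?_
      rw [one_mul]
      exact hδ x hx) (fun x hx => by
      have hb : ∀ y w C : ℝ, |w| ≤ C → |F y * w| ≤ C := fun y w C h => by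
        rw [abs_mul]
        calc |F y| * |w| ≤ 1 * C := mul_le_mul (hF1 y) h (abs_nonneg _) zero_le_one
          _ = C := one_mul C
      have h2 := hb (z' x) _ _ (hNA' x hx)
      have h3 := hb (z x) _ _ (hNA x hx)
      exact (abs_sub _ _).trans (by linarith))
  have hB0 : 0 ≤ B := (abs_nonneg _).trans (hkB a ⟨le_rfl, by linarith⟩)
  have h2 : |∫ x in a..b, g x / N x * (F (z' x) * (N x - N' x))| ≤ B * κ * (b - a) := by
    have := intervalIntegral.norm_integral_le_of_norm_le_const (a := a) (b := b) (C := B * κ)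
      (f := fun x => g x / N x * (F (z' x) * (N x - N' x))) (fun x hx => by
        rw [uIoc_of_le hab] at hx
        have hx' : x ∈ Icc a b := ⟨hx.1.le, hx.2⟩
        have hκ' := hκ x hx'
        rw [abs_sub_comm] at hκ'
        rw [norm_mul, norm_mul]
        calc _ ≤ B * (1 * κ) := by
              refine mul_le_mul (hkB x ⟨hx'.1, by linarith [hx'.2]⟩) ?_ (by positivity) hB0
              exact mul_le_mul (hF1 _) hκ' (norm_nonneg _) zero_le_one
          _ = _ := by ring)
    rwa [abs_of_nonneg (by linarith : 0 ≤ b - a)] at this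
  have h3 : ∫ x in a..b, g x * (F (z' x) - F (z x)) =
      (∫ x in a..b, g x / N x * (F (z' x) * N' x - F (z x) * N x)) +
        ∫ x in a..b, g x / N x * (F (z' x) * (N x - N' x)) := by
    rw [← intervalIntegral.integral_add ((by fun_prop : Continuous _).intervalIntegrable _ _)
      ((by fun_prop : Continuous _).intervalIntegrable _ _)]
    congr 1
    ext x
    have := hN0 x
    field_simp
    ring
  rw [h3]
  exact (abs_add_le _ _).trans (add_le_add h1 h2)

/-! ### Duality with smooth test functions -/

open scoped Manifold ContDiff in
/-- Indicators are limits of smooth functions in the weighted space `L¹ (|f| dx)`, by regularity of the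
measure `|f| dx`. -/
lemma exists_smooth_approx_indicator {f : ℝ → ℝ} (hf : Integrable f (leb 0 1)) {A : Set ℝ}
    (hA : MeasurableSet A) {ε : ℝ} (hε : 0 < ε) :
    ∃ F : ℝ → ℝ, ContDiff ℝ 1 F ∧ (∀ x, F x ∈ Icc (0 : ℝ) 1) ∧ (∀ x, 1 ≤ x → F x = 0) ∧
      |∫ x, f x * (F x - A.indicator 1 x) ∂(leb 0 1)| ≤ ε := by
  set ν : Measure ℝ := (leb 0 1).withDensity fun x => ‖f x‖ₑ
  have hν : IsFiniteMeasure ν := isFiniteMeasure_withDensity hf.hasFiniteIntegral.ne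
  have hε2 : ENNReal.ofReal (ε / 2) ≠ 0 := by simpa using hε
  have hA' : MeasurableSet (A ∩ Ioo 0 1) := hA.inter measurableSet_Ioo
  obtain ⟨K, hKA, hK, hKν⟩ := hA'.exists_isCompact_sdiff_lt (measure_ne_top ν _) hε2
  obtain ⟨U, hKU, hU, -, hUν⟩ := hK.measurableSet.exists_isOpen_sdiff_lt (measure_ne_top ν _) hε2
  obtain ⟨F, hF, hFr, hFs, hF1⟩ := exists_contMDiff_support_eq_eq_one_iff (n := 1) 𝓘(ℝ, ℝ)
    (hU.inter (isOpen_Ioo (a := (0 : ℝ)) (b := 1))) hK.isClosed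
    (subset_inter hKU fun x hx => (hKA hx).2)
  have hF01 : ∀ x, F x ∈ Icc (0 : ℝ) 1 := fun x => hFr (mem_range_self x)
  have hF0 : ∀ x, x ∉ U ∩ Ioo 0 1 → F x = 0 := fun x hx => by
    rw [← hFs] at hx
    simpa using hx
  refine ⟨F, hF.contDiff, hF01, fun x hx => hF0 x fun h => absurd h.2.2 (not_lt.2 hx), ?_⟩
  set S : Set ℝ := ((A ∩ Ioo 0 1) \ K) ∪ (U \ K)
  have hS : MeasurableSet S :=
    (hA'.diff hK.measurableSet).union (hU.measurableSet.diff hK.measurableSet)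
  have hνS : ν S ≤ ENNReal.ofReal ε := by
    calc ν S ≤ ENNReal.ofReal (ε / 2) + ENNReal.ofReal (ε / 2) :=
          (measure_union_le _ _).trans (add_le_add hKν.le hUν.le)
      _ = ENNReal.ofReal ε := by
          rw [← ENNReal.ofReal_add (by positivity) (by positivity), add_halves]
  rw [withDensity_apply _ hS] at hνS
  have hpt : ∀ x ∈ Ioo (0 : ℝ) 1, ‖f x * (F x - A.indicator 1 x)‖ ≤ S.indicator (fun x => ‖f x‖) x := by
    intro x hx
    rw [norm_mul]
    by_cases hxK : x ∈ K
    · have h1 : F x = 1 := (hF1 x).1 hxK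
      have h2 : x ∈ A := (hKA hxK).1
      simp only [h1, indicator_of_mem h2, Pi.one_apply, sub_self, norm_zero, mul_zero]
      exact indicator_nonneg (fun _ _ => norm_nonneg _) _
    · by_cases hxS : x ∈ S
      · rw [indicator_of_mem hxS]
        have h1 : ‖F x - A.indicator 1 x‖ ≤ 1 := by
          have h2 := hF01 x
          have h3 : A.indicator (1 : ℝ → ℝ) x ∈ Icc (0 : ℝ) 1 := by
            by_cases h : x ∈ A <;> simp [h]
          rw [Real.norm_eq_abs, abs_le]
          constructor <;> linarith [h2.1, h2.2, h3.1, h3.2]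
        calc ‖f x‖ * ‖F x - A.indicator 1 x‖ ≤ ‖f x‖ * 1 := by gcongr
          _ = ‖f x‖ := mul_one _
      · have h1 : x ∉ U := fun h => hxS (Or.inr ⟨h, hxK⟩)
        have h2 : x ∉ A := fun h => hxS (Or.inl ⟨⟨h, hx⟩, hxK⟩)
        rw [hF0 x fun h => h1 h.1, indicator_of_notMem h2, indicator_of_notMem hxS]
        simp
  rw [← Real.norm_eq_abs]
  calc ‖∫ x, f x * (F x - A.indicator 1 x) ∂(leb 0 1)‖
      ≤ ∫ x, S.indicator (fun x => ‖f x‖) x ∂(leb 0 1) := by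
        refine norm_integral_le_of_norm_le (hf.norm.indicator hS) ?_
        exact (ae_restrict_mem measurableSet_Ioo).mono hpt
    _ = ∫ x in S, ‖f x‖ ∂(leb 0 1) := integral_indicator hS
    _ = (∫⁻ x in S, ‖f x‖ₑ ∂(leb 0 1)).toReal := by
        rw [integral_norm_eq_lintegral_enorm hf.aestronglyMeasurable.restrict]
    _ ≤ ε := ENNReal.toReal_le_of_le_ofReal hε.le hνS

lemma integrable_mul_of_bounded {f F : ℝ → ℝ} (hf : Integrable f (leb 0 1)) (hF : Measurable F)
    {C : ℝ} (hC : ∀ x, |F x| ≤ C) : Integrable (fun x => f x * F x) (leb 0 1) :=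
  hf.mul_bdd (c := C) hF.aestronglyMeasurable (Eventually.of_forall hC)

lemma exists_smooth_integral_mul_near_indicator {f : ℝ → ℝ} (hf : Integrable f (leb 0 1)) {A : Set ℝ}
    (hA : MeasurableSet A) {ε : ℝ} (hε : 0 < ε) :
    ∃ F : ℝ → ℝ, ContDiff ℝ 1 F ∧ (∀ x, F x ∈ Icc (0 : ℝ) 1) ∧ (∀ x, 1 ≤ x → F x = 0) ∧
      |(∫ x in (0 : ℝ)..1, f x * F x) - ∫ x, A.indicator f x ∂(leb 0 1)| ≤ ε := by
  obtain ⟨F, h1, h2, h3, h4⟩ := exists_smooth_approx_indicator hf hA hε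
  refine ⟨F, h1, h2, h3, ?_⟩
  rw [← integral_leb zero_le_one, ← integral_sub
    (integrable_mul_of_bounded hf h1.continuous.measurable (C := 1) fun x => by
      rw [abs_of_nonneg (h2 x).1]; exact (h2 x).2) (hf.indicator hA)]
  convert h4 using 3
  ext x
  by_cases h : x ∈ A <;> simp [h, mul_sub]

/-- The `L¹` norm is a supremum over test functions: approximate the sign of `f`. -/
lemma integral_abs_le_of_forall_smooth {f : ℝ → ℝ} (hf : Integrable f (leb 0 1)) {E : ℝ}
    (h : ∀ F : ℝ → ℝ, ContDiff ℝ 1 F → (∀ x, |F x| ≤ 1) → (∀ x, 1 ≤ x → F x = 0) →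
      ∫ x in (0 : ℝ)..1, f x * F x ≤ E) :
    ∫ x in (0 : ℝ)..1, |f x| ≤ E := by
  set g := hf.aestronglyMeasurable.mk f
  have hg : StronglyMeasurable g := hf.aestronglyMeasurable.stronglyMeasurable_mk
  have hfg : f =ᵐ[leb 0 1] g := hf.aestronglyMeasurable.ae_eq_mk
  have hA : MeasurableSet {x | 0 < g x} := measurableSet_lt measurable_const hg.measurable
  refine le_of_forall_pos_le_add fun ε hε => ?_
  obtain ⟨F, h1, h2, h3, h4⟩ := exists_smooth_integral_mul_near_indicator hf hA (half_pos hε)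
  obtain ⟨F', h1', h2', h3', h4'⟩ := exists_smooth_integral_mul_near_indicator hf hA.compl (half_pos hε)
  have hh := h (fun x => F x - F' x) (h1.sub h1') (fun x => by
    have a1 := h2 x
    have a2 := h2' x
    rw [abs_le]; constructor <;> linarith [a1.1, a1.2, a2.1, a2.2])
    (fun x hx => by rw [h3 x hx, h3' x hx, sub_zero])
  have hfi := (intervalIntegrable_iff_integrable_leb zero_le_one).2 hf
  simp only [mul_sub] at hh
  rw [intervalIntegral.integral_sub (hfi.mul_continuousOn h1.continuous.continuousOn)
    (hfi.mul_continuousOn h1'.continuous.continuousOn)] at hh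
  have e : ∫ x in (0 : ℝ)..1, |f x| = (∫ x, {x | 0 < g x}.indicator f x ∂(leb 0 1)) -
      ∫ x, {x | 0 < g x}ᶜ.indicator f x ∂(leb 0 1) := by
    rw [← integral_leb zero_le_one, ← integral_sub (hf.indicator hA) (hf.indicator hA.compl)]
    refine integral_congr_ae ?_
    filter_upwards [hfg] with x hx
    by_cases hx' : 0 < g x
    · have : x ∉ {x | 0 < g x}ᶜ := fun h => h hx'
      rw [indicator_of_mem (show x ∈ {x | 0 < g x} from hx'), indicator_of_notMem this, sub_zero,
        abs_of_pos (hx ▸ hx')]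
    · rw [indicator_of_notMem (show x ∉ {x | 0 < g x} from hx'),
        indicator_of_mem (show x ∈ {x | 0 < g x}ᶜ from hx'), zero_sub, abs_of_nonpos]
      rw [hx]; exact not_lt.1 hx'
  have a1 := abs_le.1 h4
  have a2 := abs_le.1 h4'
  rw [e]
  linarith [a1.1, a1.2, a2.1, a2.2]

lemma ae_nonpos_of_forall_smooth {f : ℝ → ℝ} (hf : Integrable f (leb 0 1))
    (h : ∀ F : ℝ → ℝ, ContDiff ℝ 1 F → (∀ x, 0 ≤ F x) → (∀ x, 1 ≤ x → F x = 0) →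
      ∫ x in (0 : ℝ)..1, f x * F x ≤ 0) :
    ∀ᵐ x ∂(leb 0 1), f x ≤ 0 := by
  set g := hf.aestronglyMeasurable.mk f
  have hg : StronglyMeasurable g := hf.aestronglyMeasurable.stronglyMeasurable_mk
  have hfg : f =ᵐ[leb 0 1] g := hf.aestronglyMeasurable.ae_eq_mk
  have hA : MeasurableSet {x | 0 < g x} := measurableSet_lt measurable_const hg.measurable
  have h0 : ∫ x, {x | 0 < g x}.indicator f x ∂(leb 0 1) ≤ 0 := by
    refine le_of_forall_pos_le_add fun ε hε => ?_
    obtain ⟨F, h1, h2, h3, h4⟩ := exists_smooth_integral_mul_near_indicator hf hA hε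
    have := h F h1 (fun x => (h2 x).1) h3
    linarith [(abs_le.1 h4).1]
  have hnn : 0 ≤ᵐ[leb 0 1] {x | 0 < g x}.indicator f := by
    filter_upwards [hfg] with x hx
    by_cases hx' : 0 < g x
    · rw [indicator_of_mem (show x ∈ {x | 0 < g x} from hx'), hx]; exact hx'.le
    · rw [indicator_of_notMem (show x ∉ {x | 0 < g x} from hx')]; exact le_rfl
  have h1 := (integral_eq_zero_iff_of_nonneg_ae hnn (hf.indicator hA)).1
    (le_antisymm h0 (integral_nonneg_of_ae hnn))
  filter_upwards [hfg, h1] with x hx hx1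
  by_contra hpos
  have hx' : 0 < g x := by rw [← hx]; exact not_le.1 hpos
  rw [indicator_of_mem (show x ∈ {x | 0 < g x} from hx')] at hx1
  exact hpos (le_of_eq hx1)

/-- Interpolation between `L¹` and `L^∞`. -/
lemma eLpNorm_le_of_bound {f : ℝ → ℝ} (hf : Integrable f (leb 0 1)) {R E : ℝ} (hR : 0 ≤ R)
    (hfR : ∀ᵐ x ∂(leb 0 1), |f x| ≤ R) (hE : ∫ x in (0 : ℝ)..1, |f x| ≤ E)
    {p : ℝ≥0∞} (hp : 1 ≤ p) (hp' : p < ∞) :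
    eLpNorm f p (leb 0 1) ≤ ENNReal.ofReal ((R ^ (p.toReal - 1) * E) ^ (1 / p.toReal)) := by
  have hp1 : 1 ≤ p.toReal := by
    rw [← ENNReal.toReal_one]; exact ENNReal.toReal_mono hp'.ne hp
  have hE0 : 0 ≤ E := (intervalIntegral.integral_nonneg zero_le_one fun _ _ => abs_nonneg _).trans hE
  have h1 : ∫⁻ x, ‖f x‖ₑ ∂(leb 0 1) ≤ ENNReal.ofReal E := by
    have h2 := eLpNorm_one_leb zero_le_one hf
    rw [eLpNorm_one_eq_lintegral_enorm] at h2
    rw [h2]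
    exact ENNReal.ofReal_le_ofReal hE
  rw [eLpNorm_eq_lintegral_rpow_enorm_toReal (by positivity) hp'.ne,
    ← ENNReal.ofReal_rpow_of_nonneg (by positivity) (by positivity)]
  gcongr
  calc ∫⁻ x, ‖f x‖ₑ ^ p.toReal ∂(leb 0 1)
      ≤ ∫⁻ x, ENNReal.ofReal (R ^ (p.toReal - 1)) * ‖f x‖ₑ ∂(leb 0 1) := by
        refine lintegral_mono_ae ?_
        filter_upwards [hfR] with x hx
        have e : p.toReal = (p.toReal - 1) + 1 := by ring
        rw [← ofReal_norm, ENNReal.ofReal_rpow_of_nonneg (norm_nonneg _) (by positivity),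
          ← ENNReal.ofReal_mul (by positivity)]
        refine ENNReal.ofReal_le_ofReal ?_
        nth_rw 1 [e]
        rw [Real.rpow_add_one' (norm_nonneg _) (by linarith)]
        exact mul_le_mul_of_nonneg_right (Real.rpow_le_rpow (norm_nonneg _) hx (by linarith))
          (norm_nonneg _)
    _ = ENNReal.ofReal (R ^ (p.toReal - 1)) * ∫⁻ x, ‖f x‖ₑ ∂(leb 0 1) :=
        lintegral_const_mul' _ _ ENNReal.ofReal_ne_top
    _ ≤ _ := by
        rw [ENNReal.ofReal_mul (by positivity)]
        gcongr

/-! ### Bounds for weak solutions -/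

/-- Smooth antitone functions with values in `[0, 1]` that vanish on `[1, ∞)` and tend to `1`
on `(-∞, 1)`. -/
noncomputable def spaceCutoff (n : ℕ) (x : ℝ) : ℝ := Real.smoothTransition (n * (1 - x))

lemma spaceCutoff_contDiff (n : ℕ) : ContDiff ℝ 1 (spaceCutoff n) :=
  Real.smoothTransition.contDiff.comp (by fun_prop)

lemma spaceCutoff_mem (n : ℕ) (x : ℝ) : spaceCutoff n x ∈ Icc (0 : ℝ) 1 :=
  ⟨Real.smoothTransition.nonneg _, Real.smoothTransition.le_one _⟩

lemma abs_spaceCutoff_le (n : ℕ) (x : ℝ) : |spaceCutoff n x| ≤ 1 := by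
  rw [abs_of_nonneg (spaceCutoff_mem n x).1]
  exact (spaceCutoff_mem n x).2

lemma spaceCutoff_of_one_le (n : ℕ) {x : ℝ} (hx : 1 ≤ x) : spaceCutoff n x = 0 :=
  Real.smoothTransition.zero_of_nonpos (mul_nonpos_of_nonneg_of_nonpos (by positivity) (by linarith))

lemma spaceCutoff_antitone (n : ℕ) : Antitone (spaceCutoff n) := fun x y hxy =>
  Real.smoothTransition.monotone (by gcongr)

lemma tendsto_spaceCutoff {x : ℝ} (hx : x < 1) :
    Tendsto (fun n => spaceCutoff n x) atTop (𝓝 1) := by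
  have h : Tendsto (fun n : ℕ => (n : ℝ) * (1 - x)) atTop atTop :=
    tendsto_natCast_atTop_atTop.atTop_mul_const (by linarith)
  refine tendsto_const_nhds.congr' ?_
  filter_upwards [h.eventually_ge_atTop 1] with n hn
  exact (Real.smoothTransition.one_of_one_le hn).symm

lemma tendsto_integral_mul_spaceCutoff {f : ℝ → ℝ} (hf : IntervalIntegrable f volume 0 1) :
    Tendsto (fun n => ∫ x in (0 : ℝ)..1, f x * spaceCutoff n x) atTop
      (𝓝 (∫ x in (0 : ℝ)..1, f x)) := by
  refine intervalIntegral.tendsto_integral_filter_of_dominated_convergence (fun x => |f x|)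
    (Eventually.of_forall fun n => ?_) (Eventually.of_forall fun n => Eventually.of_forall
      fun x _ => ?_) hf.abs ?_
  · exact (hf.mul_continuousOn
      (spaceCutoff_contDiff n).continuous.continuousOn).def'.aestronglyMeasurable
  · rw [norm_mul]
    calc ‖f x‖ * ‖spaceCutoff n x‖ ≤ ‖f x‖ * 1 := by gcongr; exact abs_spaceCutoff_le n x
      _ = |f x| := mul_one _
  · have hne : ∀ᵐ t : ℝ, t ≠ 1 := by simp [ae_iff, measure_singleton]
    filter_upwards [hne] with x hne hx
    rw [uIoc_of_le zero_le_one] at hx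
    simpa using (tendsto_spaceCutoff (lt_of_le_of_ne hx.2 hne)).const_mul (f x)

/-- Removes the initial time, at which the weak form on `[0, 0]` carries no information. -/
lemma le_of_forall_Ioc_le {T C : ℝ} (hT : 0 < T) {f : ℝ → ℝ} (hf : ContinuousOn f (Icc 0 T))
    (h : ∀ t ∈ Ioc 0 T, f t ≤ C) : ∀ t ∈ Icc 0 T, f t ≤ C := by
  intro t ht
  rcases ht.1.eq_or_lt with h0 | h0
  · subst h0
    have h1 : Tendsto f (𝓝[Ioc 0 T] 0) (𝓝 (f 0)) :=
      (hf 0 ht).mono_left (nhdsWithin_mono _ Ioc_subset_Icc_self)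
    have h2 : (𝓝[Ioc 0 T] (0 : ℝ)).NeBot := left_nhdsWithin_Ioc_neBot hT
    refine le_of_tendsto h1 ?_
    filter_upwards [self_mem_nhdsWithin] with s hs using h s hs
  · exact h t ⟨h0, ht.2⟩

lemma abs_integral_mul_le_of_ae_bound {a b K : ℝ} (hab : a ≤ b) {f g : ℝ → ℝ}
    (hf : ∀ᵐ x ∂(leb a b), |f x| ≤ K) (hg : IntervalIntegrable g volume a b) :
    |∫ x in a..b, f x * g x| ≤ K * ∫ x in a..b, |g x| := by
  rw [← Real.norm_eq_abs, ← intervalIntegral.integral_const_mul]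
  rw [leb_eq_restrict_Ioc, ae_restrict_iff' measurableSet_Ioc] at hf
  refine intervalIntegral.norm_integral_le_of_norm_le hab ?_ (hg.abs.const_mul K)
  filter_upwards [hf] with x hx hx'
  rw [norm_mul]
  exact mul_le_mul_of_nonneg_right (hx hx') (abs_nonneg _)

lemma leb_mono_ae {a b b' : ℝ} (h : b' ≤ b) {P : ℝ → Prop} (hP : ∀ᵐ x ∂(leb a b), P x) :
    ∀ᵐ x ∂(leb a b'), P x :=
  ae_mono (Measure.restrict_mono (Ioo_subset_Ioo_right h) le_rfl) hP

/-- An integrable function on `(a, b)`, bounded by `K` almost everywhere. -/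
structure IsBoundedBy (a b K : ℝ) (f : ℝ → ℝ) : Prop where
  integrable : IntervalIntegrable f volume a b
  bound : ∀ᵐ x ∂(leb a b), |f x| ≤ K

lemma IsBoundedBy.mono {a b b' K : ℝ} {f : ℝ → ℝ} (h : IsBoundedBy a b K f) (hab : a ≤ b')
    (hb : b' ≤ b) : IsBoundedBy a b' K f where
  integrable := h.integrable.mono_set (by
    rw [uIcc_of_le hab, uIcc_of_le (hab.trans hb)]; exact Icc_subset_Icc_right hb)
  bound := leb_mono_ae hb h.bound

lemma IsBoundedBy.abs_integral_mul_le {a b K : ℝ} {f g : ℝ → ℝ} (h : IsBoundedBy a b K f)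
    (hab : a ≤ b) (hg : Continuous g) :
    |∫ x in a..b, f x * g x| ≤ K * ∫ x in a..b, |g x| :=
  abs_integral_mul_le_of_ae_bound hab h.bound (hg.intervalIntegrable _ _)

lemma IsBoundedBy.abs_integral_mul_le_const {a b K : ℝ} {f g : ℝ → ℝ} (h : IsBoundedBy a b K f)
    (hab : a ≤ b) (hK : 0 ≤ K) (hg : Continuous g) (hg1 : ∀ x, |g x| ≤ 1) :
    |∫ x in a..b, f x * g x| ≤ K * (b - a) := by
  refine (h.abs_integral_mul_le hab hg).trans (mul_le_mul_of_nonneg_left ?_ hK)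
  calc ∫ x in a..b, |g x| ≤ ∫ x in a..b, (1 : ℝ) :=
        intervalIntegral.integral_mono hab (hg.abs.intervalIntegrable _ _) (by simp) hg1
    _ = b - a := by simp

/-- A weak solution with data bounded by `K`, together with an extension of the velocity, a continuous
extension `W` of its mass to all times with values in `[0, M]`, and the flow `X` of the velocity
`v (x, W t)`. -/
structure IsSolutionWithFlow (lam : ℝ → ℝ → ℝ) (T K M L c : ℝ) (v : ℝ → ℝ → ℝ)
    (Q : ℝ → ℝ → ℝ → ℝ) (rho0 u : ℝ → ℝ) (rho : ℝ → ℝ → ℝ) (W : ℝ → ℝ)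
    (X : ℝ → ℝ → ℝ → ℝ) : Prop where
  time_pos : 0 < T
  bound_nonneg : 0 ≤ K
  ext : IsVelocityExtension lam M L c v Q
  sol : IsWeakSolution lam T rho0 u rho
  initial : IsBoundedBy 0 1 K rho0
  inflow : IsBoundedBy 0 T K u
  cont : Continuous W
  mass_eq : ∀ t ∈ Icc 0 T, W t = mass rho t
  mass_mem : ∀ t, W t ∈ Icc 0 M
  flow : IsFlow (fun s x => v x (W s)) X

namespace IsSolutionWithFlow
variable {lam : ℝ → ℝ → ℝ} {M L c T K : ℝ} {v : ℝ → ℝ → ℝ} {Q : ℝ → ℝ → ℝ → ℝ} {W : ℝ → ℝ}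
  {X : ℝ → ℝ → ℝ → ℝ} {rho0 u : ℝ → ℝ} {rho : ℝ → ℝ → ℝ}

lemma exists_of_mass_le (hT : 0 < T) (hK : 0 ≤ K) (hv : IsVelocityExtension lam M L c v Q)
    (hsol : IsWeakSolution lam T rho0 u rho) (h0 : IsBoundedBy 0 1 K rho0)
    (hu : IsBoundedBy 0 T K u) (hM : ∀ t ∈ Icc 0 T, mass rho t ≤ M) :
    ∃ W X, IsSolutionWithFlow lam T K M L c v Q rho0 u rho W X := by
  have hmem : ∀ t : ℝ, max 0 (min T t) ∈ Icc 0 T := fun t =>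
    ⟨le_max_left _ _, max_le hT.le (min_le_left _ _)⟩
  have hW : Continuous fun t => mass rho (max 0 (min T t)) :=
    hsol.continuousOn_mass.comp_continuous (by fun_prop) hmem
  obtain ⟨X, hX⟩ := hv.exists_flow hW
  exact ⟨_, X, hT, hK, hv, hsol, h0, hu, hW, fun t ht => by simp [ht.1, ht.2],
    fun t => ⟨hsol.mass_nonneg _ (hmem t), hM _ (hmem t)⟩, hX⟩

lemma representation (h : IsSolutionWithFlow lam T K M L c v Q rho0 u rho W X) {F : ℝ → ℝ}
    (hF : ContDiff ℝ 1 F) (hF1 : ∀ x, 1 ≤ x → F x = 0) {τ : ℝ} (hτ : τ ∈ Ioc 0 T) :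
    ∫ x in (0 : ℝ)..1, rho τ x * F x =
      (∫ x in (0 : ℝ)..1, rho0 x * F (X τ 0 x)) + ∫ t in (0 : ℝ)..τ, u t * F (X τ t 0) :=
  weak_representation h.ext h.cont h.flow h.sol h.inflow.integrable h.mass_eq
    (fun t _ => h.mass_mem t) hF hF1 hτ.1 hτ.2

lemma continuous_space (h : IsSolutionWithFlow lam T K M L c v Q rho0 u rho W X) (s t : ℝ) :
    Continuous fun x => X s t x :=
  (flow_continuous h.ext h.cont h.flow).comp (f := fun x : ℝ => (s, t, x)) (by fun_prop)

lemma continuous_time (h : IsSolutionWithFlow lam T K M L c v Q rho0 u rho W X) (s x : ℝ) :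
    Continuous fun t => X s t x :=
  (flow_continuous h.ext h.cont h.flow).comp (f := fun t : ℝ => (s, t, x)) (by fun_prop)

lemma continuous_jac_space (h : IsSolutionWithFlow lam T K M L c v Q rho0 u rho W X) (s t : ℝ) :
    Continuous fun x => jac Q W X s t x :=
  (jac_continuous h.ext h.cont h.flow).comp (f := fun x : ℝ => (s, t, x)) (by fun_prop)

lemma continuous_speed_mul_jac (h : IsSolutionWithFlow lam T K M L c v Q rho0 u rho W X) :
    Continuous fun z : ℝ × ℝ => -(v 0 (W z.2) * jac Q W X z.1 z.2 0) := by
  have hc := h.cont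
  exact ((h.ext.cont.comp (f := fun z : ℝ × ℝ => ((0 : ℝ), W z.2)) (by fun_prop)).mul
    ((jac_continuous h.ext h.cont h.flow).comp (f := fun z : ℝ × ℝ => (z.1, z.2, (0 : ℝ)))
      (by fun_prop))).neg

lemma continuous_speed_mul_jac_right (h : IsSolutionWithFlow lam T K M L c v Q rho0 u rho W X) (s : ℝ) :
    Continuous fun t => -(v 0 (W t) * jac Q W X s t 0) :=
  h.continuous_speed_mul_jac.comp (f := fun t : ℝ => (s, t)) (by fun_prop)

lemma exp_le_jac (h : IsSolutionWithFlow lam T K M L c v Q rho0 u rho W X) {s t : ℝ} (x : ℝ)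
    (hst : |s - t| ≤ T) : Real.exp (-(L * T)) ≤ jac Q W X s t x := by
  refine le_trans (Real.exp_le_exp.2 ?_) (le_jac h.ext s t x)
  have := h.ext.L_pos
  gcongr

lemma jac_le_exp (h : IsSolutionWithFlow lam T K M L c v Q rho0 u rho W X) {s t : ℝ} (x : ℝ)
    (hst : |s - t| ≤ T) : jac Q W X s t x ≤ Real.exp (L * T) := by
  refine le_trans (jac_le h.ext s t x) (Real.exp_le_exp.2 ?_)
  have := h.ext.L_pos
  gcongr

lemma abs_integral_le (h : IsSolutionWithFlow lam T K M L c v Q rho0 u rho W X) {F : ℝ → ℝ}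
    (hF : ContDiff ℝ 1 F) (hF0 : ∀ x, |F x| ≤ 1) (hF1 : ∀ x, 1 ≤ x → F x = 0) {τ : ℝ}
    (hτ : τ ∈ Ioc 0 T) : |∫ x in (0 : ℝ)..1, rho τ x * F x| ≤ K * (1 + T) := by
  rw [h.representation hF hF1 hτ]
  have h1 := h.initial.abs_integral_mul_le_const zero_le_one h.bound_nonneg
    (hF.continuous.comp (h.continuous_space τ 0)) (fun x => hF0 _)
  have h2 := (h.inflow.mono hτ.1.le hτ.2).abs_integral_mul_le_const hτ.1.le h.bound_nonneg
    (hF.continuous.comp (h.continuous_time τ 0)) (fun x => hF0 _)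
  have h3 : K * (τ - 0) ≤ K * T := by
    have := h.bound_nonneg
    gcongr
    linarith [hτ.2]
  refine (abs_add_le _ _).trans ((add_le_add h1 (h2.trans h3)).trans (le_of_eq ?_))
  ring

end IsSolutionWithFlow

variable {lam : ℝ → ℝ → ℝ} {T K : ℝ} {rho0 u : ℝ → ℝ} {rho : ℝ → ℝ → ℝ}

/-- A bound of the mass by the data alone. The velocity is first extended with the a priori unknown
maximum of the mass in place of `M`. -/
lemma mass_le (hlam : IsVelocity lam) (hT : 0 < T) (hK : 0 ≤ K)
    (hsol : IsWeakSolution lam T rho0 u rho) (h0 : IsBoundedBy 0 1 K rho0)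
    (hu : IsBoundedBy 0 T K u) : ∀ t ∈ Icc 0 T, mass rho t ≤ K * (1 + T) := by
  -- any bound of the mass will do here; it disappears in the representation formula
  obtain ⟨C, hC⟩ := isCompact_Icc.exists_bound_of_continuousOn hsol.continuousOn_mass
  have hC0 : 0 ≤ C := (norm_nonneg _).trans (hC 0 ⟨le_rfl, hT.le⟩)
  obtain ⟨L, c, v, Q, hv⟩ := exists_velocityExtension hlam hC0
  obtain ⟨W, X, h⟩ := IsSolutionWithFlow.exists_of_mass_le hT hK hv hsol h0 hu
    fun t ht => (le_abs_self _).trans (hC t ht)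
  refine le_of_forall_Ioc_le hT hsol.continuousOn_mass fun τ hτ => ?_
  refine le_of_tendsto (tendsto_integral_mul_spaceCutoff
    (hsol.intervalIntegrable (Ioc_subset_Icc_self hτ))) (Eventually.of_forall fun n => ?_)
  exact (le_abs_self _).trans (h.abs_integral_le (spaceCutoff_contDiff n) (abs_spaceCutoff_le n)
    (fun x hx => spaceCutoff_of_one_le n hx) hτ)

/-- A lower bound on `[0, T]` for the speeds `|∂ₓ X τ 0 x|` and `|∂ₜ X τ t 0|` at which the flow map
covers the unit interval from the initial line and from the inflow boundary. -/
noncomputable def jacLower (L c T : ℝ) : ℝ := min 1 c * Real.exp (-(L * T))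

namespace IsSolutionWithFlow
variable {M L c : ℝ} {v : ℝ → ℝ → ℝ} {Q : ℝ → ℝ → ℝ → ℝ} {W : ℝ → ℝ} {X : ℝ → ℝ → ℝ → ℝ}

lemma jacLower_pos (h : IsSolutionWithFlow lam T K M L c v Q rho0 u rho W X) : 0 < jacLower L c T :=
  mul_pos (lt_min one_pos h.ext.c_pos) (Real.exp_pos _)

lemma jacLower_le_jac (h : IsSolutionWithFlow lam T K M L c v Q rho0 u rho W X) {s t : ℝ} (x : ℝ)
    (hst : |s - t| ≤ T) : jacLower L c T ≤ jac Q W X s t x := by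
  refine le_trans ?_ (h.exp_le_jac x hst)
  exact mul_le_of_le_one_left (Real.exp_pos _).le (min_le_left _ _)

lemma jacLower_le_speed (h : IsSolutionWithFlow lam T K M L c v Q rho0 u rho W X) {s t : ℝ}
    (hst : |s - t| ≤ T) : jacLower L c T ≤ v 0 (W t) * jac Q W X s t 0 :=
  mul_le_mul ((min_le_right _ _).trans (h.ext.left _)) (h.exp_le_jac 0 hst) (Real.exp_pos _).le
    (h.ext.c_pos.le.trans (h.ext.left _))

/-- After a change of variables, the initial and the inflow parts cover the adjacent intervals
`[X τ 0 0, X τ 0 1]` and `[0, X τ 0 0]`, and `F` vanishes beyond `1 ≤ X τ 0 1`. -/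
lemma abs_integral_le_mul_integral (h : IsSolutionWithFlow lam T K M L c v Q rho0 u rho W X)
    {F : ℝ → ℝ} (hF : ContDiff ℝ 1 F) (hF0 : ∀ x, 0 ≤ F x) (hF1 : ∀ x, 1 ≤ x → F x = 0) {τ : ℝ}
    (hτ : τ ∈ Ioc 0 T) :
    |∫ x in (0 : ℝ)..1, rho τ x * F x| ≤ K / jacLower L c T * ∫ x in (0 : ℝ)..1, F x := by
  have hκ := h.jacLower_pos
  set κ := jacLower L c T
  have hFc := hF.continuous
  have hXs := h.continuous_space τ 0
  have hXt := h.continuous_time τ 0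
  have hJ := h.continuous_jac_space τ 0
  have hN := h.continuous_speed_mul_jac_right τ
  have hτT : |τ - 0| ≤ T := by rw [sub_zero, abs_of_pos hτ.1]; exact hτ.2
  have h1 := h.initial.abs_integral_mul_le zero_le_one (hFc.comp hXs)
  have h2 := (h.inflow.mono hτ.1.le hτ.2).abs_integral_mul_le hτ.1.le (hFc.comp hXt)
  have e : ∀ y, |F y| = F y := fun y => abs_of_nonneg (hF0 y)
  simp only [Function.comp, e] at h1 h2
  have i1 : κ * ∫ x in (0 : ℝ)..1, F (X τ 0 x) ≤ ∫ y in (X τ 0 0)..(X τ 0 1), F y := by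
    rw [← intervalIntegral.integral_comp_mul_deriv (f := fun x => X τ 0 x) (g := F)
      (fun x _ => flow_hasDerivAt_space h.ext h.cont h.flow τ 0 x) hJ.continuousOn hFc,
      ← intervalIntegral.integral_const_mul]
    refine intervalIntegral.integral_mono_on zero_le_one
      ((by fun_prop : Continuous _).intervalIntegrable _ _)
      (((hFc.comp hXs).mul hJ).intervalIntegrable _ _) fun x _ => ?_
    rw [mul_comm]
    exact mul_le_mul_of_nonneg_left (h.jacLower_le_jac x hτT) (hF0 _)
  have i2 : κ * ∫ t in (0 : ℝ)..τ, F (X τ t 0) ≤ ∫ y in (0 : ℝ)..(X τ 0 0), F y := by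
    have := intervalIntegral.integral_comp_mul_deriv (f := fun t => X τ t 0) (g := F)
      (a := 0) (b := τ) (fun t _ => flow_hasDerivAt_time h.ext h.cont h.flow τ t 0)
      hN.continuousOn hFc
    rw [h.flow.init] at this
    rw [intervalIntegral.integral_symm (X τ 0 0) 0, ← this, ← intervalIntegral.integral_neg,
      ← intervalIntegral.integral_const_mul]
    refine intervalIntegral.integral_mono_on hτ.1.le
      ((by fun_prop : Continuous _).intervalIntegrable _ _)
      (((hFc.comp hXt).mul hN).neg.intervalIntegrable _ _) fun t ht => ?_
    have ht' : |τ - t| ≤ T := by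
      rw [abs_of_nonneg (by linarith [ht.2])]; linarith [ht.1, hτ.2]
    have := mul_le_mul_of_nonneg_left (h.jacLower_le_speed ht') (hF0 (X τ t 0))
    simp only [Function.comp]
    linarith
  have i3 : ∫ y in (0 : ℝ)..(X τ 0 1), F y = ∫ y in (0 : ℝ)..1, F y := by
    have hX1 : 1 ≤ X τ 0 1 := one_le_flow h.ext h.flow hτ.1.le le_rfl
    rw [← intervalIntegral.integral_add_adjacent_intervals (b := 1)
      (hFc.intervalIntegrable _ _) (hFc.intervalIntegrable _ _)]
    have : ∫ y in (1 : ℝ)..(X τ 0 1), F y = ∫ y in (1 : ℝ)..(X τ 0 1), (0 : ℝ) :=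
      intervalIntegral.integral_congr fun y hy => by
        rw [uIcc_of_le hX1] at hy
        exact hF1 y hy.1
    rw [this]
    simp
  have i4 := intervalIntegral.integral_add_adjacent_intervals
    (hFc.intervalIntegrable (μ := volume) 0 (X τ 0 0)) (hFc.intervalIntegrable (X τ 0 0) (X τ 0 1))
  rw [h.representation hF hF1 hτ, div_mul_eq_mul_div, le_div_iff₀ hκ]
  calc _ ≤ (K * (∫ x in (0 : ℝ)..1, F (X τ 0 x)) + K * ∫ t in (0 : ℝ)..τ, F (X τ t 0)) * κ := by
        gcongr
        exact (abs_add_le _ _).trans (add_le_add h1 h2)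
    _ = K * (κ * (∫ x in (0 : ℝ)..1, F (X τ 0 x)) + κ * ∫ t in (0 : ℝ)..τ, F (X τ t 0)) := by ring
    _ ≤ K * ∫ x in (0 : ℝ)..1, F x := by
        have := h.bound_nonneg
        gcongr
        linarith

lemma ae_abs_le (h : IsSolutionWithFlow lam T K M L c v Q rho0 u rho W X) {τ : ℝ} (hτ : τ ∈ Icc 0 T) :
    ∀ᵐ x ∂(leb 0 1), |rho τ x| ≤ K / jacLower L c T := by
  set B := K / jacLower L c T
  have hpair : ∀ σ : ℝ, |σ| = 1 → ∀ F : ℝ → ℝ, ContDiff ℝ 1 F → (∀ x, 0 ≤ F x) →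
      (∀ x, 1 ≤ x → F x = 0) → ∫ x in (0 : ℝ)..1, (σ * rho τ x - B) * F x ≤ 0 := by
    intro σ hσ F hF hF0 hF1
    have hint := (h.sol.intervalIntegrable hτ).mul_continuousOn hF.continuous.continuousOn
    have e : ∫ x in (0 : ℝ)..1, (σ * rho τ x - B) * F x =
        σ * (∫ x in (0 : ℝ)..1, rho τ x * F x) - B * ∫ x in (0 : ℝ)..1, F x := by
      rw [← intervalIntegral.integral_const_mul, ← intervalIntegral.integral_const_mul,
        ← intervalIntegral.integral_sub (hint.const_mul σ)
          ((hF.continuous.intervalIntegrable _ _).const_mul B)]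
      congr 1
      ext x
      ring
    have hcont := h.sol.continuousOn_pairing (G := fun _ x => F x)
      (hF.continuous.comp continuous_snd)
    have := le_of_forall_Ioc_le h.time_pos (C := B * ∫ x in (0 : ℝ)..1, F x)
      (hcont.const_smul σ) (fun t ht => by
        have := h.abs_integral_le_mul_integral hF hF0 hF1 ht
        refine (le_abs_self _).trans ?_
        rw [Pi.smul_apply, smul_eq_mul, abs_mul, hσ, one_mul]
        exact this) τ hτ
    rw [e]
    simp only [Pi.smul_apply, smul_eq_mul] at this
    linarith
  have hint : Integrable (rho τ) (leb 0 1) :=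
    (intervalIntegrable_iff_integrable_leb zero_le_one).1 (h.sol.intervalIntegrable hτ)
  have hfin : IsFiniteMeasure (leb 0 1) := by
    unfold leb; infer_instance
  have h1 := ae_nonpos_of_forall_smooth ((hint.const_mul 1).sub (integrable_const B))
    (hpair 1 abs_one)
  have h2 := ae_nonpos_of_forall_smooth ((hint.const_mul (-1)).sub (integrable_const B))
    (hpair (-1) (by simp))
  filter_upwards [h1, h2] with x hx1 hx2
  simp only [Pi.sub_apply] at hx1 hx2
  rw [abs_le]
  constructor <;> linarith

end IsSolutionWithFlow

/-! ### Stability of the mass and of the flow -/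

/-- The distance of two pairs of data in `L¹ (0, 1) × L¹ (0, T)`. -/
noncomputable def dataDist (T : ℝ) (rho0 u rho0' u' : ℝ → ℝ) : ℝ :=
  (∫ x in (0 : ℝ)..1, |rho0' x - rho0 x|) + ∫ t in (0 : ℝ)..T, |u' t - u t|

/-- Grönwall's inequality in integral form. -/
lemma le_mul_exp_of_le_integral {T D C : ℝ} (hD : 0 ≤ D) (hC : 0 < C) {w : ℝ → ℝ}
    (hw : Continuous w) (hw0 : ∀ t, 0 ≤ w t)
    (h : ∀ t ∈ Icc 0 T, w t ≤ D + C * ∫ s in (0 : ℝ)..t, w s) :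
    ∀ t ∈ Icc 0 T, w t ≤ Real.exp (C * T) * D := by
  intro t ht
  have hd : ∀ t, HasDerivAt (fun t => ∫ s in (0 : ℝ)..t, w s) (w t) t := fun t =>
    intervalIntegral.integral_hasDerivAt_right (hw.intervalIntegrable _ _)
      (hw.stronglyMeasurableAtFilter _ _) hw.continuousAt
  have hnn : ∀ t ∈ Icc 0 T, 0 ≤ ∫ s in (0 : ℝ)..t, w s := fun t ht =>
    intervalIntegral.integral_nonneg ht.1 fun s _ => hw0 s
  have h1 := norm_le_gronwallBound_of_norm_deriv_right_le (f := fun t => ∫ s in (0 : ℝ)..t, w s)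
    (f' := w) (δ := 0) (K := C) (ε := D) (a := 0) (b := T)
    (continuous_iff_continuousAt.2 fun t => (hd t).continuousAt).continuousOn
    (fun t _ => (hd t).hasDerivWithinAt) (by simp) (fun s hs => by
      have hs' : s ∈ Icc 0 T := Ico_subset_Icc_self hs
      rw [Real.norm_eq_abs, Real.norm_eq_abs, abs_of_nonneg (hw0 s), abs_of_nonneg (hnn s hs')]
      linarith [h s hs']) t ht
  rw [gronwallBound_of_K_ne_0 hC.ne', Real.norm_eq_abs, abs_of_nonneg (hnn t ht)] at h1
  simp only [zero_mul, sub_zero, zero_add] at h1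
  have h2 := h t ht
  have h3 : C * ∫ s in (0 : ℝ)..t, w s ≤ D * (Real.exp (C * t) - 1) := by
    calc C * ∫ s in (0 : ℝ)..t, w s ≤ C * (D / C * (Real.exp (C * t) - 1)) := by gcongr
      _ = _ := by field_simp
  have h4 : Real.exp (C * t) ≤ Real.exp (C * T) := by
    apply Real.exp_le_exp.2
    have := ht.2
    gcongr
  nlinarith

lemma dataDist_nonneg {T : ℝ} (hT : 0 < T) (rho0 u rho0' u' : ℝ → ℝ) :
    0 ≤ dataDist T rho0 u rho0' u' :=
  add_nonneg (intervalIntegral.integral_nonneg zero_le_one fun _ _ => abs_nonneg _)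
    (intervalIntegral.integral_nonneg hT.le fun _ _ => abs_nonneg _)

/-- The rate in the Grönwall inequality for the difference of two masses. -/
noncomputable def massRate (L c T K : ℝ) : ℝ :=
  4 * K * (L * Real.exp (L * T)) / jacLower L c T

lemma abs_sub_le_of_pairing {f f' : ℝ → ℝ} {a b E : ℝ} (hab : a ≤ b)
    (hf : IntervalIntegrable f volume a b) (hf' : IntervalIntegrable f' volume a b)
    {G G' : ℝ → ℝ} (hG : Continuous G) (hG' : Continuous G') (hG1 : ∀ x, |G' x| ≤ 1)
    (hE : |∫ x in a..b, f x * (G' x - G x)| ≤ E) :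
    |(∫ x in a..b, f' x * G' x) - ∫ x in a..b, f x * G x| ≤ (∫ x in a..b, |f' x - f x|) + E := by
  have e : (∫ x in a..b, f' x * G' x) - ∫ x in a..b, f x * G x =
      (∫ x in a..b, (f' x - f x) * G' x) + ∫ x in a..b, f x * (G' x - G x) := by
    rw [← intervalIntegral.integral_sub (hf'.mul_continuousOn hG'.continuousOn)
      (hf.mul_continuousOn hG.continuousOn), ← intervalIntegral.integral_add
      ((hf'.sub hf).mul_continuousOn hG'.continuousOn)
      (hf.mul_continuousOn (by fun_prop : Continuous fun x => G' x - G x).continuousOn)]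
    congr 1
    ext x
    ring
  rw [e]
  have := abs_integral_mul_le hab (hf'.sub hf) (g := G') (C := 1) fun x _ => hG1 x
  rw [one_mul] at this
  exact (abs_add_le _ _).trans (add_le_add this hE)

namespace IsSolutionWithFlow
variable {lam : ℝ → ℝ → ℝ} {M L c T K : ℝ} {v : ℝ → ℝ → ℝ} {Q : ℝ → ℝ → ℝ → ℝ}
  {W W' : ℝ → ℝ} {X X' : ℝ → ℝ → ℝ → ℝ} {rho0 u rho0' u' : ℝ → ℝ} {rho rho' : ℝ → ℝ → ℝ}

lemma abs_flow_sub_le (h : IsSolutionWithFlow lam T K M L c v Q rho0 u rho W X)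
    (h' : IsSolutionWithFlow lam T K M L c v Q rho0' u' rho' W' X') {τ t : ℝ} (x : ℝ) (ht : 0 ≤ t)
    (htτ : t ≤ τ) (hτ : τ ≤ T) :
    |X' τ t x - X τ t x| ≤ L * Real.exp (L * T) * ∫ r in (0 : ℝ)..τ, |W' r - W r| := by
  have hL := h.ext.L_pos
  have hc := h.cont
  have hc' := h'.cont
  have hi : ∀ a b, IntervalIntegrable (fun r => |W' r - W r|) volume a b := fun a b =>
    (by fun_prop : Continuous fun r => |W' r - W r|).intervalIntegrable a b
  refine (abs_flow_sub_flow_le h.ext h.cont h.flow h'.cont h'.flow x htτ).trans ?_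
  gcongr
  · exact intervalIntegral.integral_nonneg htτ fun _ _ => abs_nonneg _
  · linarith
  · rw [← intervalIntegral.integral_add_adjacent_intervals (hi 0 t) (hi t τ)]
    have : 0 ≤ ∫ r in (0 : ℝ)..t, |W' r - W r| :=
      intervalIntegral.integral_nonneg ht fun _ _ => abs_nonneg _
    linarith

lemma abs_integral_sub_le (h : IsSolutionWithFlow lam T K M L c v Q rho0 u rho W X)
    (h' : IsSolutionWithFlow lam T K M L c v Q rho0' u' rho' W' X') {F : ℝ → ℝ}
    (hF : ContDiff ℝ 1 F) (hF0 : ∀ x, |F x| ≤ 1) (hF1 : ∀ x, 1 ≤ x → F x = 0) {τ : ℝ}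
    (hτ : τ ∈ Ioc 0 T) {E₁ E₂ : ℝ}
    (hE₁ : |∫ x in (0 : ℝ)..1, rho0 x * (F (X' τ 0 x) - F (X τ 0 x))| ≤ E₁)
    (hE₂ : |∫ t in (0 : ℝ)..τ, u t * (F (X' τ t 0) - F (X τ t 0))| ≤ E₂) :
    |(∫ x in (0 : ℝ)..1, rho' τ x * F x) - ∫ x in (0 : ℝ)..1, rho τ x * F x| ≤
      dataDist T rho0 u rho0' u' + E₁ + E₂ := by
  have hu := (h.inflow.mono hτ.1.le hτ.2).integrable
  have hu' := (h'.inflow.mono hτ.1.le hτ.2).integrable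
  have b1 := abs_sub_le_of_pairing zero_le_one h.initial.integrable h'.initial.integrable
    (hF.continuous.comp (h.continuous_space τ 0)) (hF.continuous.comp (h'.continuous_space τ 0))
    (fun x => hF0 _) hE₁
  have b2 := abs_sub_le_of_pairing hτ.1.le hu hu'
    (hF.continuous.comp (h.continuous_time τ 0)) (hF.continuous.comp (h'.continuous_time τ 0))
    (fun x => hF0 _) hE₂
  have b3 : ∫ t in (0 : ℝ)..τ, |u' t - u t| ≤ ∫ t in (0 : ℝ)..T, |u' t - u t| :=
    intervalIntegral.integral_mono_interval le_rfl hτ.1.le hτ.2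
      (Eventually.of_forall fun _ => abs_nonneg _)
      (h'.inflow.integrable.sub h.inflow.integrable).abs
  rw [h.representation hF hF1 hτ, h'.representation hF hF1 hτ, dataDist]
  simp only [Function.comp] at b1 b2
  rw [abs_le] at b1 b2 ⊢
  constructor <;> linarith [b1.1, b1.2, b2.1, b2.2]

lemma abs_mass_sub_le_integral (h : IsSolutionWithFlow lam T K M L c v Q rho0 u rho W X)
    (h' : IsSolutionWithFlow lam T K M L c v Q rho0' u' rho' W' X') {τ : ℝ} (hτ : τ ∈ Ioc 0 T) :
    |W' τ - W τ| ≤ dataDist T rho0 u rho0' u' +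
      massRate L c T K * ∫ r in (0 : ℝ)..τ, |W' r - W r| := by
  have hκ := h.jacLower_pos
  have hK := h.bound_nonneg
  have hτ' : τ ∈ Icc 0 T := Ioc_subset_Icc_self hτ
  set δ := L * Real.exp (L * T) * ∫ r in (0 : ℝ)..τ, |W' r - W r| with hδ
  have hE : ∀ n : ℕ, |(∫ x in (0 : ℝ)..1, rho' τ x * spaceCutoff n x) -
      ∫ x in (0 : ℝ)..1, rho τ x * spaceCutoff n x| ≤ dataDist T rho0 u rho0' u' +
        K * (2 * δ / jacLower L c T) + K * (2 * δ / jacLower L c T) := by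
    intro n
    have hFc := (spaceCutoff_contDiff n).continuous
    have c1 := h.continuous_space τ 0
    have c1' := h'.continuous_space τ 0
    have c2 := h.continuous_time τ 0
    have c2' := h'.continuous_time τ 0
    have s1 : ∫ x in (0 : ℝ)..1, |spaceCutoff n (X' τ 0 x) - spaceCutoff n (X τ 0 x)| ≤
        2 * δ / jacLower L c T :=
      integral_abs_comp_sub_comp_le (σ := 1) (z := fun x => X τ 0 x) (z' := fun x => X' τ 0 x)
        zero_le_one hκ hFc (spaceCutoff_antitone n)
        (spaceCutoff_mem n) c1' (h.continuous_jac_space τ 0)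
        (flow_hasDerivAt_space h.ext h.cont h.flow τ 0) abs_one
        (fun x _ => by
          rw [one_mul]
          exact h.jacLower_le_jac x (by rw [sub_zero, abs_of_pos hτ.1]; exact hτ.2))
        (fun x _ => h.abs_flow_sub_le h' x le_rfl hτ.1.le hτ.2)
    have s2 : ∫ t in (0 : ℝ)..τ, |spaceCutoff n (X' τ t 0) - spaceCutoff n (X τ t 0)| ≤
        2 * δ / jacLower L c T :=
      integral_abs_comp_sub_comp_le (σ := -1) (z := fun t => X τ t 0) (z' := fun t => X' τ t 0)
        hτ.1.le hκ hFc (spaceCutoff_antitone n)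
        (spaceCutoff_mem n) c2' (h.continuous_speed_mul_jac_right τ)
        (fun t => flow_hasDerivAt_time h.ext h.cont h.flow τ t 0) (by simp)
        (fun t ht => by
          rw [neg_one_mul, neg_neg]
          refine h.jacLower_le_speed ?_
          rw [abs_of_nonneg (by linarith [ht.2])]; linarith [ht.1, hτ.2])
        (fun t ht => h.abs_flow_sub_le h' 0 ht.1 ht.2 hτ.2)
    have t1 := h.initial.abs_integral_mul_le zero_le_one
      (g := fun x => spaceCutoff n (X' τ 0 x) - spaceCutoff n (X τ 0 x)) (by fun_prop)
    have t2 := (h.inflow.mono hτ.1.le hτ.2).abs_integral_mul_le hτ.1.le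
      (g := fun t => spaceCutoff n (X' τ t 0) - spaceCutoff n (X τ t 0)) (by fun_prop)
    exact abs_integral_sub_le h h' (spaceCutoff_contDiff n) (abs_spaceCutoff_le n)
      (fun x hx => spaceCutoff_of_one_le n hx) hτ
      (t1.trans (mul_le_mul_of_nonneg_left s1 hK)) (t2.trans (mul_le_mul_of_nonneg_left s2 hK))
  have hlim := ((tendsto_integral_mul_spaceCutoff (h'.sol.intervalIntegrable hτ')).sub
    (tendsto_integral_mul_spaceCutoff (h.sol.intervalIntegrable hτ'))).abs
  have := le_of_tendsto hlim (Eventually.of_forall hE)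
  rw [h.mass_eq τ hτ', h'.mass_eq τ hτ']
  refine this.trans (le_of_eq ?_)
  rw [massRate, hδ]
  ring

lemma abs_mass_sub_le (h : IsSolutionWithFlow lam T K M L c v Q rho0 u rho W X)
    (h' : IsSolutionWithFlow lam T K M L c v Q rho0' u' rho' W' X') {t : ℝ} (ht : t ∈ Icc 0 T) :
    |W' t - W t| ≤
      Real.exp ((massRate L c T K + 1) * T) * dataDist T rho0 u rho0' u' := by
  have hc := h.cont
  have hc' := h'.cont
  have hw : Continuous fun t => |W' t - W t| := by fun_prop
  have hR : 0 ≤ massRate L c T K := by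
    have := h.bound_nonneg
    have := h.jacLower_pos
    have := h.ext.L_pos
    unfold massRate
    positivity
  refine le_mul_exp_of_le_integral (dataDist_nonneg h.time_pos _ _ _ _) (by linarith) hw
    (fun _ => abs_nonneg _) ?_ t ht
  -- `massRate` may vanish, so the rate is increased by one
  have hIc : Continuous fun t => ∫ r in (0 : ℝ)..t, |W' r - W r| :=
    intervalIntegral.continuous_primitive (fun a b => hw.intervalIntegrable a b) 0
  have key := le_of_forall_Ioc_le h.time_pos (C := 0)
    (f := fun t => |W' t - W t| - (dataDist T rho0 u rho0' u' +
      (massRate L c T K + 1) * ∫ r in (0 : ℝ)..t, |W' r - W r|))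
    (by fun_prop) (fun τ hτ => by
      have h1 := h.abs_mass_sub_le_integral h' hτ
      have h2 : 0 ≤ ∫ r in (0 : ℝ)..τ, |W' r - W r| :=
        intervalIntegral.integral_nonneg hτ.1.le fun _ _ => abs_nonneg _
      linarith)
  intro s hs
  linarith [key s hs]

end IsSolutionWithFlow

/-! ### Stability in the `L¹` norm -/

lemma abs_exp_sub_exp_le {a b C : ℝ} (ha : a ≤ C) (hb : b ≤ C) :
    |Real.exp a - Real.exp b| ≤ Real.exp C * |a - b| := by
  have := Convex.norm_image_sub_le_of_norm_hasDerivWithin_le (f := Real.exp) (f' := Real.exp)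
    (s := Iic C) (C := Real.exp C) (x := b) (y := a)
    (fun x _ => (Real.hasDerivAt_exp x).hasDerivWithinAt) (fun x hx => by
      rw [Real.norm_eq_abs, Real.abs_exp]; exact Real.exp_le_exp.2 hx) (convex_Iic C) hb ha
  simpa using this

/-- The jacobians are close once the masses and the characteristics are, uniformly over all flows,
by uniform continuity of `Q` on a compact set containing the characteristics. -/
lemma exists_jac_close {lam : ℝ → ℝ → ℝ} {M L c : ℝ} {v : ℝ → ℝ → ℝ} {Q : ℝ → ℝ → ℝ → ℝ}
    (hv : IsVelocityExtension lam M L c v Q) {T : ℝ} (hT : 0 < T) {ε : ℝ} (hε : 0 < ε) :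
    ∃ d > 0, ∀ {W W' : ℝ → ℝ} {X X' : ℝ → ℝ → ℝ → ℝ}, Continuous W → Continuous W' →
      (∀ t, W t ∈ Icc 0 M) → (∀ t, W' t ∈ Icc 0 M) →
      IsFlow (fun s x => v x (W s)) X → IsFlow (fun s x => v x (W' s)) X' →
      ∀ {τ t x : ℝ}, 0 ≤ t → t ≤ τ → τ ≤ T → x ∈ Icc (0 : ℝ) 1 →
      (∀ r ∈ Icc t τ, |W' r - W r| ≤ d) → (∀ r ∈ Icc t τ, |X' r t x - X r t x| ≤ d) →
      |jac Q W' X' τ t x - jac Q W X τ t x| ≤ ε := by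
  have hL := hv.L_pos
  set R := 1 + L * T
  set S : Set (ℝ × ℝ × ℝ) := Icc (-R) R ×ˢ Icc (-R) R ×ˢ Icc 0 M
  have hS : IsCompact S := isCompact_Icc.prod (isCompact_Icc.prod isCompact_Icc)
  have huc := hS.uniformContinuousOn_of_continuous hv.cont_slope.continuousOn
  rw [Metric.uniformContinuousOn_iff] at huc
  set ω := ε / (Real.exp (L * T) * T)
  have hω : 0 < ω := by positivity
  obtain ⟨d, hd, hQ⟩ := huc ω hω
  refine ⟨d / 2, half_pos hd, ?_⟩
  intro W W' X X' hW hW' hWm hWm' hX hX' τ t x ht htτ hτ hx hWd hXd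
  have hc : Continuous fun r => Q (X r t x) (X r t x) (W r) := by
    have := hX.continuous_left t x
    exact hv.cont_slope.comp (f := fun r => (X r t x, X r t x, W r)) (by fun_prop)
  have hc' : Continuous fun r => Q (X' r t x) (X' r t x) (W' r) := by
    have := hX'.continuous_left t x
    exact hv.cont_slope.comp (f := fun r => (X' r t x, X' r t x, W' r)) (by fun_prop)
  have hmem : ∀ {W : ℝ → ℝ} {X : ℝ → ℝ → ℝ → ℝ}, (∀ t, W t ∈ Icc 0 M) →
      IsFlow (fun s x => v x (W s)) X → ∀ r ∈ Icc t τ, (X r t x, X r t x, W r) ∈ S := by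
    intro W X hWm hX r hr
    have h1 := abs_flow_sub_self_le hv hX r t t x
    rw [hX.init, abs_of_nonneg (by linarith [hr.1] : 0 ≤ r - t)] at h1
    have h2 : L * (r - t) ≤ L * T := by gcongr; linarith [hr.2]
    have h3 := abs_le.1 (h1.trans h2)
    have h4 : X r t x ∈ Icc (-R) R :=
      ⟨by simp only [R]; linarith [h3.1, hx.1], by simp only [R]; linarith [h3.2, hx.2]⟩
    exact ⟨h4, h4, hWm r⟩
  have hpt : ∀ r ∈ Icc t τ,
      |Q (X' r t x) (X' r t x) (W' r) - Q (X r t x) (X r t x) (W r)| ≤ ω := by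
    intro r hr
    refine (hQ _ (hmem hWm' hX' r hr) _ (hmem hWm hX r hr) ?_).le
    have h1 := hWd r hr
    have h2 := hXd r hr
    simp only [Prod.dist_eq, Real.dist_eq]
    exact max_lt (by linarith) (max_lt (by linarith) (by linarith))
  have hint : |(∫ r in t..τ, Q (X' r t x) (X' r t x) (W' r)) -
      ∫ r in t..τ, Q (X r t x) (X r t x) (W r)| ≤ ω * T := by
    rw [← intervalIntegral.integral_sub (hc'.intervalIntegrable _ _) (hc.intervalIntegrable _ _),
      ← Real.norm_eq_abs]
    refine (intervalIntegral.norm_integral_le_of_norm_le_const fun r hr => ?_).trans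
      (mul_le_mul_of_nonneg_left (b := |τ - t|) ?_ hω.le)
    · rw [uIoc_of_le htτ] at hr
      exact hpt r ⟨hr.1.le, hr.2⟩
    · rw [abs_of_nonneg (by linarith)]; linarith
  have hle : ∀ f g k : ℝ → ℝ, ∫ r in t..τ, Q (f r) (g r) (k r) ≤ L * T := fun f g k => by
    refine (le_abs_self _).trans ((abs_integral_slope_le hv _ _ _ _ _).trans ?_)
    gcongr
    rw [abs_of_nonneg (by linarith)]; linarith
  unfold jac
  calc _ ≤ Real.exp (L * T) * (ω * T) :=
        (abs_exp_sub_exp_le (hle _ _ _) (hle _ _ _)).trans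
          (mul_le_mul_of_nonneg_left hint (Real.exp_pos _).le)
    _ = ε := by simp only [ω]; field_simp

/-- `abs_integral_mul_comp_sub_comp_le` for a continuous family `z τ` of reference curves, with all
constants chosen uniformly in `τ`; `g / N` is uniformly continuous on a compact set. -/
lemma exists_pairing_close {T β : ℝ} (hβ : 0 < β) {g : ℝ → ℝ} (hg : Continuous g)
    {z N : ℝ → ℝ → ℝ} (hz : ∀ τ x, HasDerivAt (z τ) (N τ x) x)
    (hN : Continuous fun y : ℝ × ℝ => N y.1 y.2) (hN0 : ∀ τ x, N τ x ≠ 0) {E : ℝ} (hE : 0 < E) :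
    ∃ d > 0, ∀ {τ b : ℝ} {z' N' F : ℝ → ℝ}, τ ∈ Icc 0 T → b ∈ Icc 0 β → Continuous F →
      (∀ x, |F x| ≤ 1) → (∀ x, HasDerivAt z' (N' x) x) → Continuous N' →
      (∀ x ∈ Icc 0 b, |z' x - z τ x| ≤ d) → (∀ x ∈ Icc 0 b, |N' x - N τ x| ≤ d) →
      |∫ x in (0 : ℝ)..b, g x * (F (z' x) - F (z τ x))| ≤ E := by
  set S : Set (ℝ × ℝ) := Icc 0 T ×ˢ Icc 0 (β + 1)
  have hS : IsCompact S := isCompact_Icc.prod isCompact_Icc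
  have hk : Continuous fun y : ℝ × ℝ => g y.2 / N y.1 y.2 :=
    (hg.comp continuous_snd).div hN fun y => hN0 _ _
  obtain ⟨B₀, hB₀⟩ := hS.exists_bound_of_continuousOn hk.continuousOn
  obtain ⟨A₀, hA₀⟩ := hS.exists_bound_of_continuousOn hN.continuousOn
  set B := max B₀ 0
  set A := max A₀ 0
  have hB0 : 0 ≤ B := le_max_right _ _
  have hA0 : 0 ≤ A := le_max_right _ _
  have hB : ∀ τ ∈ Icc 0 T, ∀ x ∈ Icc 0 (β + 1), |g x / N τ x| ≤ B := fun τ hτ x hx =>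
    (hB₀ (τ, x) ⟨hτ, hx⟩).trans (le_max_left _ _)
  have hA : ∀ τ ∈ Icc 0 T, ∀ x ∈ Icc 0 (β + 1), |N τ x| ≤ A := fun τ hτ x hx =>
    (hA₀ (τ, x) ⟨hτ, hx⟩).trans (le_max_left _ _)
  have huc := hS.uniformContinuousOn_of_continuous hk.continuousOn
  rw [Metric.uniformContinuousOn_iff] at huc
  set ω := E / (3 * (2 * (A + 1)) * β)
  have hω : 0 < ω := by positivity
  obtain ⟨s₀, hs₀, hs⟩ := huc ω hω
  set s := min (s₀ / 2) 1
  have hs0 : 0 < s := lt_min (half_pos hs₀) one_pos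
  have hs1 : s ≤ 1 := min_le_right _ _
  have hss : s < s₀ := (min_le_left _ _).trans_lt (half_lt_self hs₀)
  set C := 2 * B + 2 * B / s * β + B * β + 1
  have hC : 0 < C := by positivity
  set d := min 1 (E / (3 * C))
  have hd0 : 0 < d := lt_min one_pos (by positivity)
  have hd1 : d ≤ 1 := min_le_left _ _
  have hdC : C * d ≤ E / 3 := by
    calc C * d ≤ C * (E / (3 * C)) := by gcongr; exact min_le_right _ _
      _ = E / 3 := by field_simp
  refine ⟨d, hd0, ?_⟩
  intro τ b z' N' F hτ hb hF hF1 hz' hN' hzd hNd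
  have hNτ : Continuous (N τ) := hN.comp (f := fun x : ℝ => (τ, x)) (by fun_prop)
  have hNA : ∀ x ∈ Icc 0 b, |N τ x| ≤ A := fun x hx =>
    hA τ hτ x ⟨hx.1, by linarith [hx.2, hb.2]⟩
  refine (abs_integral_mul_comp_sub_comp_le hb.1 hs0 (B := B) (ω := ω) (A := A + 1) (δ := d)
    (κ := d) hF hF1 hg (hz τ) hz' hNτ hN' (hN0 τ)
    (fun x hx => hB τ hτ x ⟨hx.1, by linarith [hx.2, hb.2]⟩) ?_
    (fun x hx => (hNA x hx).trans (by linarith)) ?_ hzd hNd).trans ?_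
  · intro x hx y hy
    refine (hs (τ, y) ⟨hτ, hx.1.trans hy.1, by linarith [hy.2, hx.2, hb.2]⟩ (τ, x)
      ⟨hτ, hx.1, by linarith [hx.2, hb.2]⟩ ?_).le
    simp only [Prod.dist_eq, dist_self, Real.dist_eq]
    refine max_lt hs₀ ?_
    rw [abs_of_nonneg (by linarith [hy.1])]
    linarith [hy.2]
  · intro x hx
    have h1 := abs_le.1 (hNd x hx)
    have h2 := abs_le.1 (hNA x hx)
    rw [abs_le]
    constructor <;> linarith
  · rw [sub_zero]
    have h1 : ω * (2 * (A + 1)) * b ≤ E / 3 := by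
      calc ω * (2 * (A + 1)) * b ≤ ω * (2 * (A + 1)) * β := by gcongr; exact hb.2
        _ = E / 3 := by simp only [ω]; field_simp
    have h2 : (2 * B + 2 * B / s * b) * d + B * d * b ≤ C * d := by
      have h3 : 2 * B / s * b ≤ 2 * B / s * β := by gcongr; exact hb.2
      have h4 : B * b ≤ B * β := by gcongr; exact hb.2
      calc (2 * B + 2 * B / s * b) * d + B * d * b = (2 * B + 2 * B / s * b + B * b) * d := by ring
        _ ≤ C * d := by gcongr; simp only [C]; linarith
    linarith

instance (a b : ℝ) : IsFiniteMeasure (leb a b) := by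
  unfold leb; infer_instance

lemma exists_continuous_integral_abs_sub_le {a b : ℝ} (hab : a ≤ b) {f : ℝ → ℝ}
    (hf : IntervalIntegrable f volume a b) {ε : ℝ} (hε : 0 < ε) :
    ∃ g : ℝ → ℝ, Continuous g ∧ ∫ x in a..b, |f x - g x| ≤ ε := by
  obtain ⟨g, -, hg, hgc, -⟩ := ((intervalIntegrable_iff_integrable_leb hab).1
    hf).exists_hasCompactSupport_integral_sub_le hε
  rw [integral_leb hab] at hg
  exact ⟨g, hgc, hg⟩

lemma abs_integral_mul_le_of_approx {a b e ε : ℝ} (hab : a ≤ b) {f g D : ℝ → ℝ}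
    (hf : IntervalIntegrable f volume a b) (hg : Continuous g) (hD : Continuous D)
    (hD2 : ∀ x, |D x| ≤ 2) (hfg : ∫ x in a..b, |f x - g x| ≤ ε)
    (he : |∫ x in a..b, g x * D x| ≤ e) : |∫ x in a..b, f x * D x| ≤ 2 * ε + e := by
  have hg' : IntervalIntegrable g volume a b := hg.intervalIntegrable _ _
  have h1 := abs_integral_mul_le hab (hf.sub hg') (g := D) (C := 2) fun x _ => hD2 x
  have h2 : ∫ x in a..b, f x * D x =
      (∫ x in a..b, (f x - g x) * D x) + ∫ x in a..b, g x * D x := by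
    rw [← intervalIntegral.integral_add ((hf.sub hg').mul_continuousOn hD.continuousOn)
      (hg'.mul_continuousOn hD.continuousOn)]
    congr 1
    ext x
    ring
  rw [h2]
  refine (abs_add_le _ _).trans (add_le_add (h1.trans ?_) he)
  linarith

namespace IsSolutionWithFlow
variable {lam : ℝ → ℝ → ℝ} {M L c T K : ℝ} {v : ℝ → ℝ → ℝ} {Q : ℝ → ℝ → ℝ → ℝ}
  {W W' : ℝ → ℝ} {X X' : ℝ → ℝ → ℝ → ℝ} {rho0 u rho0' u' : ℝ → ℝ} {rho rho' : ℝ → ℝ → ℝ}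

lemma abs_flow_sub_le_dataDist (h : IsSolutionWithFlow lam T K M L c v Q rho0 u rho W X)
    (h' : IsSolutionWithFlow lam T K M L c v Q rho0' u' rho' W' X') {τ t : ℝ} (x : ℝ) (ht : 0 ≤ t)
    (htτ : t ≤ τ) (hτ : τ ≤ T) :
    |X' τ t x - X τ t x| ≤ L * Real.exp (L * T) * T *
      Real.exp ((massRate L c T K + 1) * T) * dataDist T rho0 u rho0' u' := by
  have hL := h.ext.L_pos
  have h0 : 0 ≤ τ := ht.trans htτ
  have hD := dataDist_nonneg h.time_pos rho0 u rho0' u'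
  refine (h.abs_flow_sub_le h' x ht htτ hτ).trans ?_
  have h1 := intervalIntegral.norm_integral_le_of_norm_le_const (a := 0) (b := τ)
    (f := fun r => |W' r - W r|)
    (C := Real.exp ((massRate L c T K + 1) * T) * dataDist T rho0 u rho0' u') fun r hr => by
      rw [uIoc_of_le h0] at hr
      rw [Real.norm_eq_abs, abs_abs]
      exact h.abs_mass_sub_le h' ⟨hr.1.le, hr.2.trans hτ⟩
  rw [sub_zero, abs_of_nonneg h0] at h1
  have h2 := (le_abs_self _).trans h1
  calc _ ≤ L * Real.exp (L * T) *
        (Real.exp ((massRate L c T K + 1) * T) * dataDist T rho0 u rho0' u' * T) := by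
        gcongr
        refine h2.trans ?_
        gcongr
    _ = _ := by ring

lemma abs_speed_mul_jac_sub_le (h : IsSolutionWithFlow lam T K M L c v Q rho0 u rho W X)
    {J' t τ : ℝ} (hst : |τ - t| ≤ T) :
    |-(v 0 (W' t) * J') - -(v 0 (W t) * jac Q W X τ t 0)| ≤
      L * |J' - jac Q W X τ t 0| + L * Real.exp (L * T) * |W' t - W t| := by
  have hL := h.ext.L_pos
  have e : -(v 0 (W' t) * J') - -(v 0 (W t) * jac Q W X τ t 0) =
      -(v 0 (W' t) * (J' - jac Q W X τ t 0)) - (v 0 (W' t) - v 0 (W t)) * jac Q W X τ t 0 := by ring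
  rw [e]
  refine (abs_sub _ _).trans (add_le_add ?_ ?_)
  · rw [abs_neg, abs_mul]
    exact mul_le_mul_of_nonneg_right (h.ext.bound _ _) (abs_nonneg _)
  · rw [abs_mul, abs_of_pos (jac_pos _ _ _)]
    calc _ ≤ L * |W' t - W t| * Real.exp (L * T) := by
          gcongr
          · exact (jac_pos _ _ _).le
          · exact h.ext.lipschitz _ _ _
          · exact h.jac_le_exp 0 hst
      _ = _ := by ring

theorem exists_forall_pairing_le (h : IsSolutionWithFlow lam T K M L c v Q rho0 u rho W X) {E : ℝ}
    (hE : 0 < E) : ∃ η > 0, ∀ {rho0' u' : ℝ → ℝ} {rho' : ℝ → ℝ → ℝ} {W' : ℝ → ℝ}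
      {X' : ℝ → ℝ → ℝ → ℝ}, IsSolutionWithFlow lam T K M L c v Q rho0' u' rho' W' X' →
      dataDist T rho0 u rho0' u' ≤ η → ∀ {F : ℝ → ℝ}, ContDiff ℝ 1 F → (∀ x, |F x| ≤ 1) →
      (∀ x, 1 ≤ x → F x = 0) → ∀ {τ : ℝ}, τ ∈ Ioc 0 T →
      |(∫ x in (0 : ℝ)..1, rho' τ x * F x) - ∫ x in (0 : ℝ)..1, rho τ x * F x| ≤ E := by
  have hT := h.time_pos
  have hL := h.ext.L_pos
  have hE16 : 0 < E / 16 := by positivity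
  have hE8 : 0 < E / 8 := by positivity
  -- the data are replaced by continuous functions, at the cost of `2 * (E / 16)` each
  obtain ⟨g₁, hg₁, hfg₁⟩ := exists_continuous_integral_abs_sub_le zero_le_one
    h.initial.integrable hE16
  obtain ⟨g₂, hg₂, hfg₂⟩ := exists_continuous_integral_abs_sub_le hT.le h.inflow.integrable hE16
  obtain ⟨d₁, hd₁, hp₁⟩ := exists_pairing_close (T := T) one_pos hg₁
    (z := fun τ x => X τ 0 x) (N := fun τ x => jac Q W X τ 0 x)
    (fun τ x => flow_hasDerivAt_space h.ext h.cont h.flow τ 0 x)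
    ((jac_continuous h.ext h.cont h.flow).comp (f := fun z : ℝ × ℝ => (z.1, (0 : ℝ), z.2))
      (by fun_prop)) (fun τ x => (jac_pos _ _ _).ne') hE8
  obtain ⟨d₂, hd₂, hp₂⟩ := exists_pairing_close (T := T) hT hg₂
    (z := fun τ t => X τ t 0) (N := fun τ t => -(v 0 (W t) * jac Q W X τ t 0))
    (fun τ t => flow_hasDerivAt_time h.ext h.cont h.flow τ t 0) h.continuous_speed_mul_jac
    (fun τ t => neg_ne_zero.2 (mul_pos (h.ext.c_pos.trans_le (h.ext.left _))
      (jac_pos _ _ _)).ne') hE8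
  set d := min d₁ d₂
  have hd : 0 < d := lt_min hd₁ hd₂
  obtain ⟨d₃, hd₃, hj⟩ := exists_jac_close h.ext hT (ε := min d (d / (2 * L)))
    (lt_min hd (by positivity))
  -- `C₂`, `C₃` and `C₄` are the factors by which the distance of the data is multiplied in the bounds
  -- for the masses, for the flows and for the contribution of the mass to the speed at the inflow
  set C₂ := Real.exp ((massRate L c T K + 1) * T)
  set C₃ := L * Real.exp (L * T) * T * C₂
  set C₄ := L * Real.exp (L * T) * C₂
  set C := C₂ + C₃ + C₄
  have hC₂ : 0 < C₂ := Real.exp_pos _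
  have hC₃ : 0 < C₃ := by positivity
  have hC₄ : 0 < C₄ := by positivity
  have hC : 0 < C := by positivity
  set m := min d₃ (d / 2)
  have hm : 0 < m := lt_min hd₃ (half_pos hd)
  refine ⟨min (E / 8) (m / C), lt_min hE8 (by positivity), ?_⟩
  intro rho0' u' rho' W' X' h' hη F hF hF0 hF1 τ hτ
  have hD0 := dataDist_nonneg hT rho0 u rho0' u'
  set D := dataDist T rho0 u rho0' u'
  have hDE : D ≤ E / 8 := hη.trans (min_le_left _ _)
  have hDm : C * D ≤ m := by
    calc C * D ≤ C * (m / C) := by gcongr; exact hη.trans (min_le_right _ _)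
      _ = m := by rw [mul_div_assoc', mul_div_cancel_left₀ _ hC.ne']
  have hCD : C₂ * D + C₃ * D + C₄ * D ≤ m := by linarith [add_mul (C₂ + C₃) C₄ D, add_mul C₂ C₃ D]
  have hn₂ : 0 ≤ C₂ * D := by positivity
  have hn₃ : 0 ≤ C₃ * D := by positivity
  have hn₄ : 0 ≤ C₄ * D := by positivity
  have hmd₃ : m ≤ d₃ := min_le_left _ _
  have hmd : m ≤ d / 2 := min_le_right _ _
  have hdd₁ : d ≤ d₁ := min_le_left _ _
  have hdd₂ : d ≤ d₂ := min_le_right _ _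
  have hWW : ∀ t ∈ Icc 0 T, |W' t - W t| ≤ C₂ * D := fun t ht => h.abs_mass_sub_le h' ht
  have hXX : ∀ {s t : ℝ} (x : ℝ), 0 ≤ t → t ≤ s → s ≤ T → |X' s t x - X s t x| ≤ C₃ * D :=
    fun x h1 h2 h3 => h.abs_flow_sub_le_dataDist h' x h1 h2 h3
  have hJJ : ∀ {t x : ℝ}, 0 ≤ t → t ≤ τ → x ∈ Icc (0 : ℝ) 1 →
      |jac Q W' X' τ t x - jac Q W X τ t x| ≤ min d (d / (2 * L)) := fun ht htτ hx =>
    hj h.cont h'.cont h.mass_mem h'.mass_mem h.flow h'.flow ht htτ hτ.2 hx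
      (fun r hr => (hWW r ⟨ht.trans hr.1, hr.2.trans hτ.2⟩).trans (by linarith))
      (fun r hr => (hXX _ ht hr.1 (hr.2.trans hτ.2)).trans (by linarith))
  have hF2 : ∀ y y', |F y - F y'| ≤ 2 := fun y y' =>
    (abs_sub _ _).trans (by linarith [hF0 y, hF0 y'])
  have hτ' : τ ∈ Icc 0 T := Ioc_subset_Icc_self hτ
  have c1 := h.continuous_space τ 0
  have c1' := h'.continuous_space τ 0
  have c2 := h.continuous_time τ 0
  have c2' := h'.continuous_time τ 0
  have hFc := hF.continuous
  have e₁ : |∫ x in (0 : ℝ)..1, rho0 x * (F (X' τ 0 x) - F (X τ 0 x))| ≤ 2 * (E / 16) + E / 8 := by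
    refine abs_integral_mul_le_of_approx zero_le_one h.initial.integrable hg₁
      (D := fun x => F (X' τ 0 x) - F (X τ 0 x)) (by fun_prop) (fun x => hF2 _ _) hfg₁ ?_
    refine hp₁ (z' := fun x => X' τ 0 x) (N' := fun x => jac Q W' X' τ 0 x) hτ'
      ⟨zero_le_one, le_rfl⟩ hFc hF0
      (fun x => flow_hasDerivAt_space h'.ext h'.cont h'.flow τ 0 x)
      (h'.continuous_jac_space τ 0) (fun x hx => ?_) (fun x hx => ?_)
    · exact (hXX x le_rfl hτ.1.le hτ.2).trans (by linarith)
    · exact (hJJ le_rfl hτ.1.le hx).trans ((min_le_left _ _).trans hdd₁)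
  have e₂ : |∫ t in (0 : ℝ)..τ, u t * (F (X' τ t 0) - F (X τ t 0))| ≤ 2 * (E / 16) + E / 8 := by
    have hfg₂' : ∫ t in (0 : ℝ)..τ, |u t - g₂ t| ≤ E / 16 :=
      (intervalIntegral.integral_mono_interval le_rfl hτ.1.le hτ.2
        (Eventually.of_forall fun _ => abs_nonneg _)
        (h.inflow.integrable.sub (hg₂.intervalIntegrable _ _)).abs).trans hfg₂
    refine abs_integral_mul_le_of_approx hτ.1.le (h.inflow.mono hτ.1.le hτ.2).integrable hg₂
      (D := fun t => F (X' τ t 0) - F (X τ t 0)) (by fun_prop) (fun x => hF2 _ _) hfg₂' ?_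
    refine hp₂ (z' := fun t => X' τ t 0) (N' := fun t => -(v 0 (W' t) * jac Q W' X' τ t 0)) hτ'
      hτ' hFc hF0
      (fun t => flow_hasDerivAt_time h'.ext h'.cont h'.flow τ t 0)
      (h'.continuous_speed_mul_jac_right τ) (fun t ht => ?_) (fun t ht => ?_)
    · exact (hXX 0 ht.1 ht.2 hτ.2).trans (by linarith)
    · have ht' : |τ - t| ≤ T := by
        rw [abs_of_nonneg (by linarith [ht.2])]; linarith [ht.1, hτ.2]
      refine (h.abs_speed_mul_jac_sub_le ht').trans ?_
      have h1 : L * |jac Q W' X' τ t 0 - jac Q W X τ t 0| ≤ d / 2 := by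
        calc _ ≤ L * (d / (2 * L)) := by
              gcongr
              exact (hJJ ht.1 ht.2 ⟨le_rfl, zero_le_one⟩).trans (min_le_right _ _)
          _ = d / 2 := by field_simp
      have h2 : L * Real.exp (L * T) * |W' t - W t| ≤ C₄ * D := by
        calc _ ≤ L * Real.exp (L * T) * (C₂ * D) := by
              gcongr
              exact hWW t ⟨ht.1, ht.2.trans hτ.2⟩
          _ = C₄ * D := by simp only [C₄]; ring
      linarith
  refine (abs_integral_sub_le h h' hF hF0 hF1 hτ e₁ e₂).trans ?_
  linarith

theorem exists_forall_integral_abs_sub_le (h : IsSolutionWithFlow lam T K M L c v Q rho0 u rho W X)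
    {E : ℝ} (hE : 0 < E) : ∃ η > 0, ∀ {rho0' u' : ℝ → ℝ} {rho' : ℝ → ℝ → ℝ} {W' : ℝ → ℝ}
      {X' : ℝ → ℝ → ℝ → ℝ}, IsSolutionWithFlow lam T K M L c v Q rho0' u' rho' W' X' →
      dataDist T rho0 u rho0' u' ≤ η → ∀ t ∈ Icc 0 T,
      ∫ x in (0 : ℝ)..1, |rho' t x - rho t x| ≤ E := by
  obtain ⟨η, hη, hpair⟩ := h.exists_forall_pairing_le hE
  refine ⟨η, hη, fun h' hD t ht => ?_⟩
  have i := h.sol.intervalIntegrable ht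
  have i' := h'.sol.intervalIntegrable ht
  refine integral_abs_le_of_forall_smooth
    ((intervalIntegrable_iff_integrable_leb zero_le_one).1 (i'.sub i)) fun F hF hF0 hF1 => ?_
  have hG : Continuous fun z : ℝ × ℝ => F z.2 := hF.continuous.comp continuous_snd
  have key := le_of_forall_Ioc_le h.time_pos (C := E)
    ((h'.sol.continuousOn_pairing (G := fun _ x => F x) hG).sub
      (h.sol.continuousOn_pairing (G := fun _ x => F x) hG))
    (fun τ hτ => (le_abs_self _).trans (hpair h' hD hF hF0 hF1 hτ)) t ht
  refine le_trans (le_of_eq ?_) key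
  simp only [sub_mul]
  exact intervalIntegral.integral_sub (i'.mul_continuousOn hF.continuous.continuousOn)
    (i.mul_continuousOn hF.continuous.continuousOn)

end IsSolutionWithFlow

/-! ### Stability in the `Lᵖ` norm -/

lemma IsLinftyPlus.isBoundedBy {a b K : ℝ} (hab : a ≤ b) {f : ℝ → ℝ} (hf : IsLinftyPlus a b f)
    (hK : eLpNorm f ∞ (leb a b) ≤ ENNReal.ofReal K) (hK0 : 0 ≤ K) : IsBoundedBy a b K f where
  integrable := (intervalIntegrable_iff_integrable_leb hab).2 (hf.memLp.integrable le_top)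
  bound := by
    filter_upwards [ae_le_eLpNormEssSup (f := f) (μ := leb a b)] with x hx
    rw [eLpNorm_exponent_top] at hK
    have := hx.trans hK
    rw [← ofReal_norm, ENNReal.ofReal_le_ofReal_iff hK0] at this
    exact this

lemma integral_abs_le_of_eLpNorm_le {b : ℝ} (hb : 0 < b) {f : ℝ → ℝ}
    (hf : Integrable f (leb 0 b)) {p : ℝ≥0∞} (hp : 1 ≤ p) {η : ℝ} (hη : 0 ≤ η)
    (h : eLpNorm f p (leb 0 b) ≤ ENNReal.ofReal η) :
    ∫ x in (0 : ℝ)..b, |f x| ≤ η * (b + 1) := by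
  have h1 := eLpNorm_le_eLpNorm_mul_rpow_measure_univ hp hf.aestronglyMeasurable
  rw [eLpNorm_one_leb hb.le hf] at h1
  have h2 : leb 0 b univ = ENNReal.ofReal b := by simp [leb]
  have hp1 : 1 / p.toReal ≤ 1 := by
    rcases eq_or_ne p ∞ with rfl | hpt
    · simp
    · have : 1 ≤ p.toReal := by
        rw [← ENNReal.toReal_one]; exact ENNReal.toReal_mono hpt hp
      exact (div_le_one (by linarith)).2 this
  have h3 : leb 0 b univ ^ (1 / (1 : ℝ≥0∞).toReal - 1 / p.toReal) ≤ ENNReal.ofReal (b + 1) := by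
    have hnn : 0 ≤ 1 / p.toReal := by positivity
    rw [h2, ENNReal.toReal_one, div_one]
    calc ENNReal.ofReal b ^ (1 - 1 / p.toReal) ≤ ENNReal.ofReal (b + 1) ^ (1 - 1 / p.toReal) := by
          gcongr
          linarith
      _ ≤ ENNReal.ofReal (b + 1) ^ (1 : ℝ) := by
          refine ENNReal.rpow_le_rpow_of_exponent_le ?_ (by linarith)
          rw [ENNReal.one_le_ofReal]
          linarith
      _ = _ := ENNReal.rpow_one _
  have h4 := h1.trans (mul_le_mul' h h3)
  rw [← ENNReal.ofReal_mul hη] at h4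
  exact (ENNReal.ofReal_le_ofReal_iff (by positivity)).1 h4

end NonlocalFlow

theorem mainTheorem2
    (lam : ℝ → ℝ → ℝ) (hlam : NonlocalFlow.IsVelocity lam)
    (T : ℝ) (hT : 0 < T)
    (rho0 u : ℝ → ℝ)
    (hrho0 : NonlocalFlow.IsLinftyPlus 0 1 rho0) (hu : NonlocalFlow.IsLinftyPlus 0 T u)
    (eps : ℝ) (heps : 0 < eps)
    (p : ℝ≥0∞) (hp : 1 ≤ p) (hp' : p < ∞)
    (K : ℝ) (hK : 0 < K)
    (hbound : eLpNorm rho0 ∞ (NonlocalFlow.leb 0 1) + eLpNorm u ∞ (NonlocalFlow.leb 0 T)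
      ≤ ENNReal.ofReal K) :
    ∃ eta : ℝ, 0 < eta ∧
      ∀ rho0' u' : ℝ → ℝ,
        NonlocalFlow.IsLinftyPlus 0 1 rho0' → NonlocalFlow.IsLinftyPlus 0 T u' →
        eLpNorm rho0' ∞ (NonlocalFlow.leb 0 1) + eLpNorm u' ∞ (NonlocalFlow.leb 0 T)
          ≤ ENNReal.ofReal K →
        eLpNorm (fun x => rho0' x - rho0 x) p (NonlocalFlow.leb 0 1)
          + eLpNorm (fun t => u' t - u t) p (NonlocalFlow.leb 0 T) < ENNReal.ofReal eta →
        ∀ rho rho' : ℝ → ℝ → ℝ,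
          NonlocalFlow.IsWeakSolution lam T rho0 u rho →
          NonlocalFlow.IsWeakSolution lam T rho0' u' rho' →
          ∀ t ∈ Icc 0 T,
            eLpNorm (fun x => rho' t x - rho t x) p (NonlocalFlow.leb 0 1)
              < ENNReal.ofReal eps := by
  open NonlocalFlow in
  by_cases hex : ∃ rhoS, IsWeakSolution lam T rho0 u rhoS
  swap
  · exact ⟨1, one_pos, fun _ _ _ _ _ _ rho _ h => absurd ⟨rho, h⟩ hex⟩
  obtain ⟨rhoS, hS⟩ := hex
  have hp1 : 1 ≤ p.toReal := by
    rw [← ENNReal.toReal_one]; exact ENNReal.toReal_mono hp'.ne hp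
  have hM : 0 ≤ K * (1 + T) := by positivity
  obtain ⟨L, c, v, Q, hv⟩ := exists_velocityExtension hlam hM
  have htrans : ∀ {rho0 u : ℝ → ℝ} {rho : ℝ → ℝ → ℝ}, IsLinftyPlus 0 1 rho0 →
      IsLinftyPlus 0 T u → eLpNorm rho0 ∞ (leb 0 1) + eLpNorm u ∞ (leb 0 T) ≤ ENNReal.ofReal K →
      IsWeakSolution lam T rho0 u rho →
      ∃ W X, IsSolutionWithFlow lam T K (K * (1 + T)) L c v Q rho0 u rho W X := by
    intro rho0 u rho h0 hu hK' hsol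
    have b0 := h0.isBoundedBy zero_le_one (le_self_add.trans hK') hK.le
    have bu := hu.isBoundedBy hT.le (le_add_self.trans hK') hK.le
    exact IsSolutionWithFlow.exists_of_mass_le hT hK.le hv hsol b0 bu
      (mass_le hlam hT hK.le hsol b0 bu)
  obtain ⟨WS, XS, hTS⟩ := htrans hrho0 hu hbound hS
  set R := 2 * (K / jacLower L c T)
  have hR : 0 < R := by
    have := hTS.jacLower_pos
    positivity
  -- `E` makes the interpolated norm `(R ^ (p - 1) * (2 * E)) ^ (1 / p)` equal to `eps / 2`
  set E := (eps / 2) ^ p.toReal / (2 * R ^ (p.toReal - 1))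
  have hE : 0 < E := by positivity
  obtain ⟨η, hη, hstab⟩ := hTS.exists_forall_integral_abs_sub_le hE
  refine ⟨η / (T + 3), by positivity, ?_⟩
  intro rho0' u' hrho0' hu' hbound' hdist rho rho' hrho hrho' t ht
  obtain ⟨W, X, hTr⟩ := htrans hrho0 hu hbound hrho
  obtain ⟨W', X', hTr'⟩ := htrans hrho0' hu' hbound' hrho'
  have hη' : 0 ≤ η / (T + 3) := by positivity
  have hD : dataDist T rho0 u rho0' u' ≤ η := by
    have h1 := integral_abs_le_of_eLpNorm_le one_pos
      ((hrho0'.memLp.sub hrho0.memLp).integrable le_top) hp hη' (le_self_add.trans hdist.le)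
    have h2 := integral_abs_le_of_eLpNorm_le hT
      ((hu'.memLp.sub hu.memLp).integrable le_top) hp hη' (le_add_self.trans hdist.le)
    simp only [Pi.sub_apply] at h1 h2
    calc dataDist T rho0 u rho0' u' ≤ η / (T + 3) * (1 + 1) + η / (T + 3) * (T + 1) :=
          add_le_add h1 h2
      _ = η := by field_simp; ring
  have hD0 : dataDist T rho0 u rho0 u ≤ η := by
    simpa [dataDist] using hη.le
  have i := hrho.intervalIntegrable ht
  have i' := hrho'.intervalIntegrable ht
  have iS := hS.intervalIntegrable ht
  have h1 : ∫ x in (0 : ℝ)..1, |rho' t x - rho t x| ≤ 2 * E := by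
    calc ∫ x in (0 : ℝ)..1, |rho' t x - rho t x|
        ≤ ∫ x in (0 : ℝ)..1, (|rho' t x - rhoS t x| + |rho t x - rhoS t x|) := by
          refine intervalIntegral.integral_mono zero_le_one (i'.sub i).abs
            ((i'.sub iS).abs.add (i.sub iS).abs) fun x => ?_
          calc |rho' t x - rho t x| = |(rho' t x - rhoS t x) - (rho t x - rhoS t x)| := by ring_nf
            _ ≤ _ := abs_sub _ _
      _ = (∫ x in (0 : ℝ)..1, |rho' t x - rhoS t x|) + ∫ x in (0 : ℝ)..1, |rho t x - rhoS t x| :=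
          intervalIntegral.integral_add (i'.sub iS).abs (i.sub iS).abs
      _ ≤ E + E := add_le_add (hstab hTr' hD t ht) (hstab hTr hD0 t ht)
      _ = 2 * E := by ring
  have h2 : ∀ᵐ x ∂(leb 0 1), |rho' t x - rho t x| ≤ R := by
    filter_upwards [hTr.ae_abs_le ht, hTr'.ae_abs_le ht] with x hx hx'
    refine (abs_sub _ _).trans ?_
    simp only [R]
    linarith
  have h3 := eLpNorm_le_of_bound ((intervalIntegrable_iff_integrable_leb zero_le_one).1 (i'.sub i))
    hR.le h2 h1 hp hp'
  refine h3.trans_lt ((ENNReal.ofReal_lt_ofReal_iff heps).2 ?_)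
  have e : R ^ (p.toReal - 1) * (2 * E) = (eps / 2) ^ p.toReal := by
    have : 0 < R ^ (p.toReal - 1) := by positivity
    simp only [E]
    field_simp
  rw [e, one_div, Real.rpow_rpow_inv (by positivity) (by positivity)]
  linarith
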